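/- A graph $G$ is a finite multigraph (self-loops and multiple edges allowed), regarded as a topological space (one-dimensional CW complex). A continuous map $\phi\colon G\to\mathbb R^n$ is rectifiable if $G$ is covered by finitely many paths $\gamma_i\colon[0,1]\to G$ such that every $\phi\circ\gamma_i$ has finite length; it is an immersion if it is locally an embedding. For continuous rectifiable $\phi\colon G\to\mathbb R^n$ and $\psi\colon H\to\mathbb R^n$, the graph Fréchet distance is $$d_{FG}\big((G,\phi),(H,\psi)\big)=\inf_{h}\ \sup_{x\in G}\|\phi(x)-\psi(h(x))\|_2\in[0,\infty],$$ where $h$ ranges over all homeomorphisms $G\to H$ (and $\inf\emptyset=\infty$). Let $\mathcal G_{\mathcal I}(G)$ be the extended metric space of classes of rectifiable immersions $G\to\mathbb R^n$ modulo Fréchet distance zero, and let $\mathcal G_{\mathcal I}$ be the extended metric space of classes of all pairs $(G,\phi)$, with $G$ a graph and $\phi\colon G\to\mathbb R^n$ a rectifiable immersion, modulo Fréchet distance zero; both carry the topology of open $d_{FG}$-balls. **Theorem.** Let $n\ge 0$. 1. For every graph $G$, any two points of $\mathcal G_{\mathcal I}(G)$ are joined by a path in $\mathcal G_{\mathcal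 I}(G)$. If $n\ge2$, then moreover $\mathcal G_{\mathcal I}(G)$ is non-empty, so that it is a non-empty path-connected space. 2. Sending the connected component of $[(G,\phi)]$ to the homeomorphism class of $G$ is a well-defined injective map from the set of connected components of $\mathcal G_{\mathcal I}$ to the set of homeomorphism classes of graphs. If $n\ge 2$, this map is a bijection. -/

import Mathlib

open Topology
open scoped ENNReal unitInterval

universe u

namespace GraphFrechet

/-- A finite multigraph; self-loops and multiple edges are allowed. Every edge carries two end
vertices, possibly equal. Naming one of them `src` and the other `tgt` only serves to glue
the edge `[0,1]`; no map or homeomorphism below is required to respect it. -/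
structure MultiGraph where
  V : Type u
  E : Type u
  [finV : Finite V]
  [finE : Finite E]
  src : E → V
  tgt : E → V

attribute [instance] MultiGraph.finV MultiGraph.finE

namespace MultiGraph

/-- The vertex set is discrete. -/
instance (G : MultiGraph.{u}) : TopologicalSpace G.V := ⊥

instance (G : MultiGraph.{u}) : DiscreteTopology G.V := ⟨rfl⟩

/-- The end points of the interval of the edge `e` are glued to the end vertices of `e`. -/
inductive Glue (G : MultiGraph.{u}) :
    G.V ⊕ (Σ _ : G.E, I) → G.V ⊕ (Σ _ : G.E, I) → Prop
  | src (e : G.E) : Glue G (Sum.inr ⟨e, 0⟩) (Sum.inl (G.src e))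
  | tgt (e : G.E) : Glue G (Sum.inr ⟨e, 1⟩) (Sum.inl (G.tgt e))

/-- The graph as a topological space (a one-dimensional CW complex): the quotient of the disjoint
union of the vertices and of one copy of `[0,1]` for each edge. -/
def Space (G : MultiGraph.{u}) : Type u := Quot G.Glue

instance (G : MultiGraph.{u}) : TopologicalSpace G.Space :=
  inferInstanceAs (TopologicalSpace (Quot G.Glue))

/-- Two graphs are identified when their underlying spaces are homeomorphic. -/
instance homeoSetoid : Setoid MultiGraph.{u} where
  r G H := Nonempty (G.Space ≃ₜ H.Space)
  iseqv :=
    { refl := fun _ => ⟨Homeomorph.refl _⟩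
      symm := fun ⟨h⟩ => ⟨h.symm⟩
      trans := fun ⟨h⟩ ⟨k⟩ => ⟨h.trans k⟩ }

end MultiGraph

/-- Homeomorphism classes of graphs. -/
def HomeoClass : Type (u + 1) := Quotient MultiGraph.homeoSetoid.{u}

/-- The homeomorphism class of a graph. -/
def homeoClass (G : MultiGraph.{u}) : HomeoClass.{u} := Quotient.mk _ G

/-- A map `φ : G → ℝⁿ` is rectifiable if `G` is covered by finitely many paths `γ i`
whose images `φ ∘ γ i` are paths of finite length. -/
def Rectifiable {n : ℕ} {G : MultiGraph.{u}} (φ : G.Space → EuclideanSpace ℝ (Fin n)) : Prop :=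
  ∃ (k : ℕ) (γ : Fin k → C(I, G.Space)),
    (∀ x : G.Space, ∃ (i : Fin k) (t : I), γ i t = x) ∧
    ∀ i : Fin k, eVariationOn (φ ∘ γ i) Set.univ < ∞

/-- Continuous rectifiable maps `G → ℝⁿ`. -/
structure RectMap (n : ℕ) (G : MultiGraph.{u}) where
  toMap : C(G.Space, EuclideanSpace ℝ (Fin n))
  rectifiable : Rectifiable toMap

/-- Continuous rectifiable graph-map pairs `(G, φ)` with `φ : G → ℝⁿ`. -/
structure GraphMap (n : ℕ) where
  graph : MultiGraph.{u}
  map : RectMap n graph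

/-- An immersion is a map that is locally an embedding. -/
def IsImmersion {X Y : Type*} [TopologicalSpace X] [TopologicalSpace Y] (φ : X → Y) : Prop :=
  ∀ x : X, ∃ U ∈ 𝓝 x, IsEmbedding (U.domRestrict φ)

/-- The graph Fréchet distance: the infimum of `‖φ - ψ ∘ h‖_∞` over all homeomorphisms `h` from
`G` to `H`; it is `∞` if there is none. -/
noncomputable def frechetDist {n : ℕ} (p q : GraphMap.{u} n) : ℝ≥0∞ :=
  ⨅ h : p.graph.Space ≃ₜ q.graph.Space,
    ⨆ x : p.graph.Space, edist (p.map.toMap x) (q.map.toMap (h x))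

theorem frechetDist_self {n : ℕ} (p : GraphMap.{u} n) : frechetDist p p = 0 :=
  le_antisymm (iInf_le_of_le (Homeomorph.refl _) (by simp)) bot_le

theorem frechetDist_le_symm {n : ℕ} (p q : GraphMap.{u} n) :
    frechetDist p q ≤ frechetDist q p := by
  refine le_iInf fun h => iInf_le_of_le h.symm (iSup_le fun x => ?_)
  refine le_trans (le_of_eq ?_)
    (le_iSup (fun y => edist (q.map.toMap y) (p.map.toMap (h y))) (h.symm x))
  simp [edist_comm]

theorem frechetDist_triangle {n : ℕ} (p q r : GraphMap.{u} n) :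
    frechetDist p r ≤ frechetDist p q + frechetDist q r := by
  unfold frechetDist
  refine ENNReal.le_iInf_add_iInf fun h k => ?_
  refine iInf_le_of_le (h.trans k) (iSup_le fun x => ?_)
  exact (edist_triangle _ (q.map.toMap (h x)) _).trans
    (add_le_add (le_iSup (fun x => edist (p.map.toMap x) (q.map.toMap (h x))) x)
      (le_iSup (fun y => edist (q.map.toMap y) (r.map.toMap (k y))) (h x)))

/-- The Fréchet distance is an extended pseudometric; the topology is that of its open balls. -/
noncomputable instance (n : ℕ) : PseudoEMetricSpace (GraphMap.{u} n) where
  edist := frechetDist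
  edist_self := frechetDist_self
  edist_comm p q := le_antisymm (frechetDist_le_symm p q) (frechetDist_le_symm q p)
  edist_triangle := frechetDist_triangle

/-- The Fréchet distance between maps of a fixed graph. -/
noncomputable instance (n : ℕ) (G : MultiGraph.{u}) : PseudoEMetricSpace (RectMap n G) :=
  PseudoEMetricSpace.induced (fun φ => (⟨G, φ⟩ : GraphMap.{u} n)) inferInstance

/-- Continuous rectifiable maps `G → ℝⁿ` modulo Fréchet distance zero. (In an extended
pseudometric space two points are inseparable exactly when their distance is zero, and the
distance descends to an extended metric on the quotient.) -/
abbrev MapClass (n : ℕ) (G : MultiGraph.{u}) := SeparationQuotient (RectMap n G)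

/-- All continuous rectifiable graph-map pairs modulo Fréchet distance zero. -/
abbrev GraphMapClass (n : ℕ) := SeparationQuotient (GraphMap.{u} n)

/-- `I(G)`: the subspace of the classes that are represented by immersions `G → ℝⁿ`. -/
def immersions (n : ℕ) (G : MultiGraph.{u}) : Set (MapClass n G) :=
  SeparationQuotient.mk '' {φ : RectMap n G | IsImmersion φ.toMap}

/-- `I`: the subspace of the classes that are represented by immersed graph-map pairs. -/
def graphImmersions (n : ℕ) : Set (GraphMapClass.{u} n) :=
  SeparationQuotient.mk '' {p : GraphMap.{u} n | IsImmersion p.map.toMap}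

/-- The point of `I` given by a graph `G` and an immersion `φ : G → ℝⁿ`. -/
noncomputable def immersedPair {n : ℕ} (G : MultiGraph.{u}) (φ : RectMap n G) (hφ : IsImmersion φ.toMap) :
    graphImmersions.{u} n :=
  ⟨SeparationQuotient.mk ⟨G, φ⟩, ⟨G, φ⟩, hφ, rfl⟩

end GraphFrechet

/-! Finite distance forces the underlying graphs to be homeomorphic, so the homeomorphism class is
locally constant and descends to connected components. The rest follows once two rectifiable
immersions `φ`, `ψ` of one graph are joined through rectifiable immersions, up to distance zero
(`exists_path_of_immersions`).

For `n ≥ 2` the straight-line homotopy may fail to be locally injective. It is repaired by adding a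
tiny but fast planar rotation of amplitude of order `ε = s(1 - s)` and speed about `K`, where `K`
stays fixed. If the homotopy is `L`-Lipschitz along the edges and `K` is large compared with `L`,
the sum is locally injective for `0 < s < 1`; transverse complex factors on the half-edges secure
this at vertices and midpoints (`exists_injOn_of_charts`, `exists_immersion_homotopy`). The
Lipschitz bound comes from a common reparametrisation (`exists_lipschitz_reparam`) and needs edges
of finite length, whereas rectifiability only speaks of some covering paths. Hausdorff measure
bridges this gap: the image has finite measure, and an injective arc is no longer than the measure
of its image (`RectMap.boundedVariationOn_edge`). Started at the zero map, the same homotopy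
immerses every graph.

For `n = 1` a locally injective function is injective on each component, with a compact interval as
image. Two such functions agree up to a homeomorphism and a positive affine rescaling of each
component, and the rescaling is interpolated linearly. For `n = 0` all maps coincide. -/

namespace GraphFrechet

/-! ### Topology of a graph. -/

namespace MultiGraph

variable (G : MultiGraph.{u})

/-- The vertex `v` as a point of the graph. -/
def vertex (v : G.V) : G.Space := Quot.mk _ (Sum.inl v)

/-- The characteristic map of the edge `e`. -/
def edge (e : G.E) : C(I, G.Space) where
  toFun t := Quot.mk _ (Sum.inr ⟨e, t⟩)
  continuous_toFun := continuous_quot_mk.comp (continuous_inr.comp continuous_sigmaMk)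

@[simp] theorem edge_zero (e : G.E) : G.edge e 0 = G.vertex (G.src e) := Quot.sound (Glue.src e)

@[simp] theorem edge_one (e : G.E) : G.edge e 1 = G.vertex (G.tgt e) := Quot.sound (Glue.tgt e)

variable {G}

theorem exists_rep (x : G.Space) : (∃ v, G.vertex v = x) ∨ ∃ e t, G.edge e t = x := by
  induction x using Quot.ind with
  | mk a =>
    rcases a with v | ⟨e, t⟩
    · exact Or.inl ⟨v, rfl⟩
    · exact Or.inr ⟨e, t, rfl⟩

/-- Every point is a vertex or an interior point of an edge. -/
theorem exists_rep_interior (x : G.Space) :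
    (∃ v, G.vertex v = x) ∨ ∃ e, ∃ t : I, t ≠ 0 ∧ t ≠ 1 ∧ G.edge e t = x := by
  rcases exists_rep x with h | ⟨e, t, rfl⟩
  · exact Or.inl h
  by_cases h0 : t = 0
  · subst h0; exact Or.inl ⟨_, (G.edge_zero e).symm⟩
  by_cases h1 : t = 1
  · subst h1; exact Or.inl ⟨_, (G.edge_one e).symm⟩
  exact Or.inr ⟨e, t, h0, h1, rfl⟩

instance : CompactSpace G.Space := inferInstanceAs (CompactSpace (Quot G.Glue))

/-- `projIcc` makes `I` a quotient of `ℝ`, and local path-connectedness passes to quotients, hence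
on to graphs. In dimension one it makes the components open. -/
instance : LocallyPathConnectedSpace I :=
  (isQuotientMap_projIcc (h := zero_le_one (α := ℝ))).locallyPathConnectedSpace

instance : LocallyPathConnectedSpace G.Space :=
  inferInstanceAs (LocallyPathConnectedSpace (Quot G.Glue))

/-- Continuous maps on a graph are given by continuous maps on the edges that agree at the
vertices. -/
def lift {Y : Type*} [TopologicalSpace Y] (f : G.V → Y) (g : G.E → C(I, Y))
    (h0 : ∀ e, g e 0 = f (G.src e)) (h1 : ∀ e, g e 1 = f (G.tgt e)) : C(G.Space, Y) where
  toFun := Quot.lift (Sum.elim f fun p => g p.1 p.2) (by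
    rintro _ _ (e | e)
    exacts [h0 e, h1 e])
  continuous_toFun := continuous_quot_lift _ <|
    continuous_of_discreteTopology.sumElim (continuous_sigma fun e => (g e).continuous)

section lift

variable {Y : Type*} [TopologicalSpace Y] (f : G.V → Y) (g : G.E → C(I, Y))
    (h0 : ∀ e, g e 0 = f (G.src e)) (h1 : ∀ e, g e 1 = f (G.tgt e))

@[simp] theorem lift_vertex (v : G.V) : lift f g h0 h1 (G.vertex v) = f v := rfl

@[simp] theorem lift_edge (e : G.E) (t : I) : lift f g h0 h1 (G.edge e t) = g e t := rfl

end lift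

open Classical in
/-- The polynomial `p` on the edge `e`, extended by zero. -/
noncomputable def bump (e : G.E) (p : Polynomial ℝ) : C(G.Space, ℝ) :=
  lift (fun _ => 0)
    (fun e' => if e' = e then ⟨fun t => (t : ℝ) * (1 - t) * p.eval (t : ℝ), by fun_prop⟩ else 0)
    (fun e' => by split_ifs <;> simp) (fun e' => by split_ifs <;> simp)

@[simp] theorem bump_vertex (e : G.E) (p : Polynomial ℝ) (v : G.V) : bump e p (G.vertex v) = 0 :=
  rfl

theorem bump_edge_self (e : G.E) (p : Polynomial ℝ) (t : I) :
    bump e p (G.edge e t) = (t : ℝ) * (1 - t) * p.eval (t : ℝ) := by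
  simp [bump]

theorem bump_edge_of_ne {e e' : G.E} (h : e' ≠ e) (p : Polynomial ℝ) (t : I) :
    bump e p (G.edge e' t) = 0 := by
  simp [bump, h]

theorem mul_one_sub_ne_zero {t : I} (h0 : t ≠ 0) (h1 : t ≠ 1) : (t : ℝ) * (1 - t) ≠ 0 := by
  refine mul_ne_zero (fun h => h0 (Subtype.ext h)) (fun h => h1 (Subtype.ext ?_))
  simpa using (sub_eq_zero.1 h).symm

/-- The value at `p = 1` is nonzero inside `e` and zero on other edges; the ratio of the values at
`X` and `1` is the parameter. -/
theorem eq_of_bump_eq {e e' : G.E} {t t' : I} (h0 : t ≠ 0) (h1 : t ≠ 1)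
    (h : ∀ p, bump e p (G.edge e t) = bump e p (G.edge e' t')) : e = e' ∧ t = t' := by
  have hne := mul_one_sub_ne_zero h0 h1
  have he : e = e' := by
    by_contra hc
    have := h 1
    rw [bump_edge_self, bump_edge_of_ne (Ne.symm hc)] at this
    simp only [Polynomial.eval_one, mul_one] at this
    exact hne this
  subst he
  have hA := h 1
  have hB := h Polynomial.X
  simp only [bump_edge_self, Polynomial.eval_one, mul_one, Polynomial.eval_X] at hA hB
  refine ⟨rfl, Subtype.ext ?_⟩
  rw [← hA] at hB
  exact mul_left_cancel₀ hne hB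

theorem edge_eq_edge {e e' : G.E} {t t' : I} (h : G.edge e t = G.edge e' t') :
    (e = e' ∧ t = t') ∨ ((t = 0 ∨ t = 1) ∧ (t' = 0 ∨ t' = 1)) := by
  by_cases ht : t = 0 ∨ t = 1
  · by_cases ht' : t' = 0 ∨ t' = 1
    · exact Or.inr ⟨ht, ht'⟩
    · push Not at ht'
      obtain ⟨rfl, rfl⟩ := eq_of_bump_eq ht'.1 ht'.2 (fun p => by rw [← h] : ∀ p,
        bump e' p (G.edge e' t') = bump e' p (G.edge e t))
      exact Or.inl ⟨rfl, rfl⟩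
  · push Not at ht
    exact Or.inl (eq_of_bump_eq ht.1 ht.2 fun p => by rw [h])

open Classical in
/-- The piecewise linear function that is `1` at the vertex `v` and `0` at the others. -/
noncomputable def hat (v : G.V) : C(G.Space, ℝ) :=
  lift (fun w => if w = v then 1 else 0)
    (fun e => ⟨fun t => (1 - (t : ℝ)) * (if G.src e = v then 1 else 0) +
      t * (if G.tgt e = v then 1 else 0), by fun_prop⟩)
    (fun e => by simp) (fun e => by simp)

/-- Real functions separate points: `hat` the vertices, `bump` all other pairs. They give a
continuous injection into a product of lines. -/
instance : T2Space G.Space := by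
  have key : ∀ x y : G.Space, (∀ f : C(G.Space, ℝ), f x = f y) → x = y := by
    intro x y h
    rcases exists_rep_interior x with ⟨v, rfl⟩ | ⟨e, t, h0, h1, rfl⟩
    · rcases exists_rep_interior y with ⟨w, rfl⟩ | ⟨e, t, h0, h1, rfl⟩
      · have := h (hat v)
        simp only [hat, lift_vertex, if_true] at this
        split_ifs at this with hw
        · rw [hw]
        · norm_num at this
      · have := h (bump e 1)
        rw [bump_vertex, bump_edge_self] at this
        simp only [Polynomial.eval_one, mul_one] at this
        exact absurd this.symm (mul_one_sub_ne_zero h0 h1)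
    · rcases exists_rep_interior y with ⟨w, rfl⟩ | ⟨e', t', h0', h1', rfl⟩
      · have := h (bump e 1)
        rw [bump_vertex, bump_edge_self] at this
        simp only [Polynomial.eval_one, mul_one] at this
        exact absurd this (mul_one_sub_ne_zero h0 h1)
      · obtain ⟨rfl, rfl⟩ := eq_of_bump_eq h0 h1 fun p => h _
        rfl
  refine T2Space.of_injective_continuous (f := fun (x : G.Space) (f : C(G.Space, ℝ)) => f x)
    (fun x y h => key x y fun f => congrFun h f) (by fun_prop)

end MultiGraph

/-! ### Immersions and reparametrisation. -/

open MultiGraph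

/-- A locally injective continuous map on a compact Hausdorff space is an immersion. -/
theorem isImmersion_of_injOn {X Y : Type*} [TopologicalSpace X] [CompactSpace X] [T2Space X]
    [TopologicalSpace Y] [T2Space Y] {φ : X → Y} (hφ : Continuous φ)
    (h : ∀ x, ∃ U ∈ 𝓝 x, Set.InjOn φ U) : IsImmersion φ := by
  intro x
  obtain ⟨U, hU, hinj⟩ := h x
  obtain ⟨K, hK, hKU, hKc⟩ := local_compact_nhds hU
  refine ⟨K, hK, ?_⟩
  have : CompactSpace K := isCompact_iff_compactSpace.1 hKc
  refine ((hφ.comp continuous_subtype_val).isClosedEmbedding ?_).isEmbedding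
  exact Set.injOn_iff_injective.1 (hinj.mono hKU)

theorem IsImmersion.exists_injOn {X Y : Type*} [TopologicalSpace X] [TopologicalSpace Y]
    {φ : X → Y} (h : IsImmersion φ) (x : X) : ∃ U ∈ 𝓝 x, Set.InjOn φ U := by
  obtain ⟨U, hU, he⟩ := h x
  exact ⟨U, hU, Set.injOn_iff_injective.2 he.injective⟩

theorem IsImmersion.comp_homeomorph {X X' Y : Type*} [TopologicalSpace X] [TopologicalSpace X']
    [CompactSpace X'] [T2Space X'] [TopologicalSpace Y] [T2Space Y]
    {φ : X → Y} (h : IsImmersion φ) (hφ : Continuous φ) (k : X' ≃ₜ X) : IsImmersion (φ ∘ k) := by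
  refine isImmersion_of_injOn (hφ.comp k.continuous) fun x => ?_
  obtain ⟨U, hU, hinj⟩ := h.exists_injOn (k x)
  exact ⟨k ⁻¹' U, k.continuous.continuousAt hU, fun a ha b hb hab => k.injective (hinj ha hb hab)⟩

/-- The distance of two maps of a graph is at most their uniform distance. -/
theorem RectMap.edist_le {n : ℕ} {G : MultiGraph.{u}} (φ ψ : RectMap n G) :
    edist φ ψ ≤ edist φ.toMap ψ.toMap := by
  refine (iInf_le _ (Homeomorph.refl G.Space)).trans (iSup_le fun x => ?_)
  rw [ContinuousMap.edist_eq_iSup]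
  exact le_iSup (fun x => edist (φ.toMap x) (ψ.toMap x)) x

/-- A jointly continuous family of rectifiable maps is a continuous family. -/
theorem RectMap.continuous_of_uncurry {n : ℕ} {G : MultiGraph.{u}} {T : Type*} [TopologicalSpace T]
    {Φ : T → RectMap n G} (h : Continuous fun p : T × G.Space => (Φ p.1).toMap p.2) :
    Continuous Φ := by
  have hc : Continuous fun s => (Φ s).toMap :=
    (ContinuousMap.curry ⟨fun p : T × G.Space => (Φ p.1).toMap p.2, h⟩).continuous
  rw [continuous_iff_continuousAt] at hc ⊢
  intro s
  have h1 := (EMetric.tendsto_nhds).1 (hc s)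
  refine (EMetric.tendsto_nhds).2 fun ε hε => ?_
  filter_upwards [h1 ε hε] with t ht
  exact (RectMap.edist_le _ _).trans_lt ht

/-- Reparametrising a map of a graph by a homeomorphism. -/
def RectMap.comp {n : ℕ} {G H : MultiGraph.{u}} (φ : RectMap n H) (k : G.Space ≃ₜ H.Space) :
    RectMap n G where
  toMap := φ.toMap.comp k
  rectifiable := by
    obtain ⟨m, γ, hγ, hv⟩ := φ.rectifiable
    refine ⟨m, fun i => (k.symm : C(H.Space, G.Space)).comp (γ i), fun x => ?_, fun i => ?_⟩
    · obtain ⟨i, t, h⟩ := hγ (k x)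
      exact ⟨i, t, by simp [h]⟩
    · convert hv i using 2
      ext t
      simp

theorem GraphMap.edist_eq_zero_of_comp {n : ℕ} {p q : GraphMap.{u} n}
    (k : p.graph.Space ≃ₜ q.graph.Space) (h : ∀ x, p.map.toMap x = q.map.toMap (k x)) :
    edist p q = 0 := by
  refine le_antisymm (iInf_le_of_le k (iSup_le fun x => ?_)) bot_le
  rw [h, edist_self]

end GraphFrechet

/-! ### Length and one-dimensional Hausdorff measure. -/

namespace GraphFrechet

open MultiGraph MeasureTheory Set

section Variation

variable {E : Type*} [MetricSpace E]

/-- The variation function of a continuous map of bounded variation is continuous. -/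
theorem continuous_variationOnFromTo {f : I → E} (hc : Continuous f)
    (hf : BoundedVariationOn f univ) (a : I) : Continuous (variationOnFromTo f univ a) := by
  rw [continuous_iff_continuousAt]
  intro x
  have hadd : variationOnFromTo f univ a =
      fun y => variationOnFromTo f univ a x + variationOnFromTo f univ x y := by
    ext y
    rw [variationOnFromTo.add hf.locallyBoundedVariationOn (mem_univ _) (mem_univ _) (mem_univ _)]
  refine continuousAt_iff_continuous_left_right.2
    ⟨?_, hf.continuousWithinAt_variationOnFromTo_Ici hc.continuousWithinAt⟩
  rw [hadd]
  refine continuousWithinAt_const.add ?_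
  -- With base point `x`, the function is minus the variation on `[y, x]` for `y ≤ x`, which tends
  -- to zero by continuity of `f`.
  suffices H : ContinuousWithinAt (fun y => -(eVariationOn f (univ ∩ Icc y x)).toReal) (Iic x) x by
    refine H.congr_of_mem (fun y hy => ?_) self_mem_Iic
    rw [variationOnFromTo.eq_neg_swap, variationOnFromTo.eq_of_le _ _ hy]
  refine ContinuousWithinAt.neg ?_
  simp only [ContinuousWithinAt, Icc_self]
  rw [eVariationOn.subsingleton _ (fun a ha b hb => ha.2.trans hb.2.symm)]
  refine (ENNReal.tendsto_toReal ENNReal.zero_ne_top).comp ?_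
  refine Filter.Tendsto.mono_left ?_ (nhdsWithin_mono _ (subset_univ _))
  exact hf.tendsto_eVariationOn_Icc_zero_left hc.continuousWithinAt

theorem dist_le_abs_variationOnFromTo_sub {f : I → E} (hf : BoundedVariationOn f univ) (a s t : I) :
    dist (f s) (f t) ≤ |variationOnFromTo f univ a s - variationOnFromTo f univ a t| := by
  wlog h : s ≤ t generalizing s t
  · rw [dist_comm, abs_sub_comm]
    exact this t s (le_of_not_ge h)
  have hadd := variationOnFromTo.add hf.locallyBoundedVariationOn (mem_univ a) (mem_univ s)
    (mem_univ t)
  rw [abs_sub_comm, ← hadd, add_sub_cancel_left, variationOnFromTo.eq_of_le _ _ h]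
  refine le_trans ?_ (le_abs_self _)
  rw [dist_edist]
  refine ENNReal.toReal_mono (hf.locallyBoundedVariationOn _ _ (mem_univ _) (mem_univ _)) ?_
  exact eVariationOn.edist_le _ ⟨mem_univ _, le_refl s, h⟩ ⟨mem_univ _, h, le_refl t⟩

/-- Two continuous paths of finite length become Lipschitz after a common reparametrisation. -/
theorem exists_lipschitz_reparam {f g : I → E} (hfc : Continuous f) (hgc : Continuous g)
    (hf : BoundedVariationOn f univ) (hg : BoundedVariationOn g univ) :
    ∃ (θ : I ≃ₜ I) (L : ℝ), 0 ≤ L ∧ θ 0 = 0 ∧ θ 1 = 1 ∧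
      (∀ s t : I, dist (f (θ s)) (f (θ t)) ≤ L * |(s : ℝ) - t|) ∧
      ∀ s t : I, dist (g (θ s)) (g (θ t)) ≤ L * |(s : ℝ) - t| := by
  set vf := variationOnFromTo f univ 0 with hvf
  set vg := variationOnFromTo g univ 0 with hvg
  have mf : Monotone vf := monotoneOn_univ.1
    (variationOnFromTo.monotoneOn hf.locallyBoundedVariationOn (mem_univ _))
  have mg : Monotone vg := monotoneOn_univ.1
    (variationOnFromTo.monotoneOn hg.locallyBoundedVariationOn (mem_univ _))
  have f0 : vf 0 = 0 := variationOnFromTo.self _ _ _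
  have g0 : vg 0 = 0 := variationOnFromTo.self _ _ _
  -- The summand `t` makes `v` strictly increasing even where both paths rest; the other two make
  -- increments of `v` dominate the displacements of `f` and `g`.
  set v : I → ℝ := fun t => t + vf t + vg t with hv
  have v0 : v 0 = 0 := by simp [hv, f0, g0]
  have hsm : StrictMono v := fun s t h =>
    add_lt_add_of_lt_of_le (add_lt_add_of_lt_of_le h (mf h.le)) (mg h.le)
  have vpos : 0 < v 1 := v0 ▸ hsm zero_lt_one
  have vc : Continuous v := (continuous_subtype_val.add (continuous_variationOnFromTo hfc hf 0)).add
    (continuous_variationOnFromTo hgc hg 0)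
  have hmem : ∀ t, v t / v 1 ∈ I := fun t =>
    ⟨div_nonneg (v0 ▸ hsm.monotone t.2.1) vpos.le,
      (div_le_one vpos).2 (hsm.monotone t.2.2)⟩
  set ρ : I → I := fun t => ⟨v t / v 1, hmem t⟩ with hρ
  have ρm : StrictMono ρ := fun s t h => Subtype.mk_lt_mk.2 (div_lt_div_of_pos_right (hsm h) vpos)
  have ρ0 : ρ 0 = 0 := Subtype.ext (by simp [hρ, v0])
  have ρ1 : ρ 1 = 1 := Subtype.ext (by simp [hρ, vpos.ne'])
  have ρc : Continuous ρ := (vc.div_const _).subtype_mk _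
  have ρs : Function.Surjective ρ := by
    intro y
    have := intermediate_value_Icc (zero_le_one (α := I)) ρc.continuousOn
    rw [ρ0, ρ1] at this
    obtain ⟨x, -, hx⟩ := this ⟨y.2.1, y.2.2⟩
    exact ⟨x, hx⟩
  let o := (ρm.orderIsoOfSurjective ρ ρs).toHomeomorph
  have ho : ∀ t, o t = ρ t := fun t => rfl
  have hos : ∀ s, ρ (o.symm s) = s := fun s => o.apply_symm_apply s
  have hkey : ∀ s t : I, |v (o.symm s) - v (o.symm t)| = v 1 * |(s : ℝ) - t| := by
    intro s t
    have h1 : ∀ s, v (o.symm s) = v 1 * s := fun s => by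
      have := congrArg Subtype.val (hos s)
      simp only [hρ] at this
      rw [← this]
      field_simp
    rw [h1, h1, ← mul_sub, abs_mul, abs_of_pos vpos]
  have hvf_le : ∀ s t, |vf s - vf t| ≤ |v s - v t| ∧ |vg s - vg t| ≤ |v s - v t| := by
    intro s t
    wlog h : s ≤ t generalizing s t
    · rw [abs_sub_comm (vf s), abs_sub_comm (vg s), abs_sub_comm (v s)]
      exact this t s (le_of_not_ge h)
    have h' : (s : ℝ) ≤ t := h
    have := mf h
    have := mg h
    have hvs : v t - v s = (t - s) + (vf t - vf s) + (vg t - vg s) := by simp only [hv]; ring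
    rw [abs_sub_comm (vf s), abs_sub_comm (vg s), abs_sub_comm (v s), hvs,
      abs_of_nonneg (by linarith), abs_of_nonneg (by linarith), abs_of_nonneg (by linarith)]
    constructor <;> linarith
  refine ⟨o.symm, v 1, vpos.le, ?_, ?_, fun s t => ?_, fun s t => ?_⟩
  · rw [Homeomorph.symm_apply_eq, ho, ρ0]
  · rw [Homeomorph.symm_apply_eq, ho, ρ1]
  · rw [← hkey]
    exact (dist_le_abs_variationOnFromTo_sub hf 0 _ _).trans (hvf_le _ _).1
  · rw [← hkey]
    exact (dist_le_abs_variationOnFromTo_sub hg 0 _ _).trans (hvf_le _ _).2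

variable [MeasurableSpace E] [BorelSpace E]

/-- The image of a path of finite length has finite one-dimensional measure. -/
theorem hausdorffMeasure_range_lt_top {f : I → E} (hf : BoundedVariationOn f univ) :
    μH[1] (range f) < ∞ := by
  set v := variationOnFromTo f univ 0 with hv
  have mv : Monotone v := monotoneOn_univ.1
    (variationOnFromTo.monotoneOn hf.locallyBoundedVariationOn (mem_univ _))
  set g := naturalParameterization f univ 0
  have hg : ∀ b, g (v b) = f b := fun b => edist_eq_zero.1
    (edist_naturalParameterization_eq_zero hf.locallyBoundedVariationOn (mem_univ _) (mem_univ b))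
  -- Parametrised by arc length the path is 1-Lipschitz, and its parameters lie in a bounded
  -- interval.
  have hlip : LipschitzOnWith 1 g (range v) := by
    refine LipschitzOnWith.of_dist_le_mul ?_
    rintro _ ⟨s, rfl⟩ _ ⟨t, rfl⟩
    rw [hg, hg, NNReal.coe_one, one_mul, Real.dist_eq]
    exact dist_le_abs_variationOnFromTo_sub hf 0 s t
  have himg : range f = g '' range v := by
    rw [← range_comp]
    exact congrArg range (funext fun b => (hg b).symm)
  rw [himg]
  refine (hlip.hausdorffMeasure_image_le zero_le_one).trans_lt ?_
  rw [hausdorffMeasure_real]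
  refine ENNReal.mul_lt_top (by simp) ?_
  refine (measure_mono (t := Icc (v 0) (v 1)) ?_).trans_lt (by simp [Real.volume_Icc])
  rintro _ ⟨t, rfl⟩
  exact ⟨mv t.2.1, mv t.2.2⟩

/-- On `[s, t)` the distance to `f s` takes every value in `[0, dist (f t) (f s))`, and this
function is 1-Lipschitz. Half-open intervals keep the pieces of a subdivision disjoint. -/
theorem edist_le_hausdorffMeasure_image_Ico {f : I → E} (hc : Continuous f) {s t : I} (h : s ≤ t) :
    edist (f t) (f s) ≤ μH[1] (f '' Ico s t) := by
  have hlip : LipschitzWith 1 fun p => dist p (f s) := LipschitzWith.dist_left (f s)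
  have hsub : Ico 0 (dist (f t) (f s)) ⊆ (fun p => dist p (f s)) '' (f '' Ico s t) := by
    intro y hy
    have := intermediate_value_Icc h (f := fun r => dist (f r) (f s))
      (by fun_prop : Continuous fun r => dist (f r) (f s)).continuousOn
    obtain ⟨r, hr, hry⟩ := this (a := y) (by rw [dist_self]; exact ⟨hy.1, hy.2.le⟩)
    refine ⟨f r, ⟨r, ⟨hr.1, lt_of_le_of_ne hr.2 ?_⟩, rfl⟩, hry⟩
    rintro rfl
    exact hy.2.ne hry.symm
  calc edist (f t) (f s) = μH[1] (Ico 0 (dist (f t) (f s))) := by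
        rw [hausdorffMeasure_real, Real.volume_Ico, sub_zero, edist_dist]
    _ ≤ μH[1] ((fun p => dist p (f s)) '' (f '' Ico s t)) := measure_mono hsub
    _ ≤ μH[1] (f '' Ico s t) := by
        simpa using hlip.hausdorffMeasure_image_le zero_le_one (f '' Ico s t)

/-- By injectivity the half-open pieces of a subdivision have disjoint measurable images, so the
measures bounding the increments add up. -/
theorem eVariationOn_Icc_le_hausdorffMeasure {f : I → E} (hc : Continuous f) {a b : I}
    (hinj : InjOn f (Icc a b)) : eVariationOn f (Icc a b) ≤ μH[1] (range f) := by
  refine iSup_le ?_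
  rintro ⟨n, u, hu, hmem⟩
  have hsub : ∀ i, Ico (u i) (u (i + 1)) ⊆ Icc a b := fun i x hx =>
    ⟨(hmem i).1.trans hx.1, hx.2.le.trans (hmem (i + 1)).2⟩
  calc ∑ i ∈ Finset.range n, edist (f (u (i + 1))) (f (u i))
      ≤ ∑ i ∈ Finset.range n, μH[1] (f '' Ico (u i) (u (i + 1))) :=
        Finset.sum_le_sum fun i _ => edist_le_hausdorffMeasure_image_Ico hc (hu (Nat.le_succ i))
    _ = μH[1] (⋃ i ∈ Finset.range n, f '' Ico (u i) (u (i + 1))) := by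
        refine (measure_biUnion_finset ?_ fun i _ => ?_).symm
        · intro i _ j _ hij
          refine disjoint_left.2 ?_
          rintro _ ⟨x, hx, rfl⟩ ⟨y, hy, hxy⟩
          have := hinj (hsub j hy) (hsub i hx) hxy
          subst this
          exact disjoint_left.1 (hu.pairwise_disjoint_on_Ico_succ hij) hx hy
        · exact measurableSet_Ico.image_of_continuousOn_injOn hc.continuousOn (hinj.mono (hsub i))
    _ ≤ μH[1] (range f) := measure_mono (iUnion₂_subset fun i _ => image_subset_range _ _)

/-- A locally injective path whose image has finite one-dimensional measure has finite length. -/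
theorem boundedVariationOn_of_locally_injOn {f : I → E} (hc : Continuous f)
    (hinj : ∀ t, ∃ U ∈ 𝓝 t, InjOn f U) (hμ : μH[1] (range f) < ∞) :
    BoundedVariationOn f univ := by
  choose U hU hUinj using hinj
  -- A Lebesgue subdivision: `f` is injective on each of finitely many pieces, so each has length at
  -- most the measure of the whole range.
  obtain ⟨t, t0, tm, ⟨N, hN⟩, hsub⟩ := exists_monotone_Icc_subset_open_cover_unitInterval
    (c := fun t => interior (U t)) (fun _ => isOpen_interior)
    (fun x _ => mem_iUnion.2 ⟨x, mem_interior_iff_mem_nhds.2 (hU x)⟩)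
  have key : ∀ n, eVariationOn f (univ ∩ Icc 0 (t n)) < ∞ := by
    intro n
    induction n with
    | zero => rw [t0, Icc_self, eVariationOn.subsingleton _ (by simp)]; simp
    | succ n ih =>
      rw [← eVariationOn.Icc_add_Icc f (t n).2.1 (tm n.le_succ) (mem_univ _)]
      obtain ⟨i, hi⟩ := hsub n
      refine ENNReal.add_lt_top.2 ⟨ih, ?_⟩
      rw [univ_inter]
      exact (eVariationOn_Icc_le_hausdorffMeasure hc
        ((hUinj i).mono (hi.trans interior_subset))).trans_lt hμ
  have := key N
  rw [hN N le_rfl] at this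
  refine ((eVariationOn.mono f fun x _ => ?_).trans_lt this).ne
  exact ⟨mem_univ _, x.2.1, x.2.2⟩

end Variation

/-- The measure of the image no longer refers to the covering paths, so it can control the edges. -/
theorem Rectifiable.hausdorffMeasure_range_lt_top {n : ℕ} {G : MultiGraph.{u}}
    {φ : G.Space → EuclideanSpace ℝ (Fin n)} (h : Rectifiable φ) : μH[1] (range φ) < ∞ := by
  obtain ⟨k, γ, hγ, hv⟩ := h
  refine (measure_mono (t := ⋃ i, range (φ ∘ γ i)) ?_).trans_lt ?_
  · rintro _ ⟨x, rfl⟩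
    obtain ⟨i, t, rfl⟩ := hγ x
    exact mem_iUnion.2 ⟨i, t, rfl⟩
  · refine (measure_iUnion_fintype_le _ _).trans_lt (ENNReal.sum_lt_top.2 fun i _ => ?_)
    exact GraphFrechet.hausdorffMeasure_range_lt_top (hv i).ne

/-- Every edge has finite length under a rectifiable immersion. -/
theorem RectMap.boundedVariationOn_edge {n : ℕ} {G : MultiGraph.{u}} (φ : RectMap n G)
    (hφ : IsImmersion φ.toMap) (e : G.E) : BoundedVariationOn (φ.toMap ∘ G.edge e) univ := by
  refine boundedVariationOn_of_locally_injOn (φ.toMap.continuous.comp (G.edge e).continuous)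
    (fun t => ?_) ((measure_mono (range_comp_subset_range _ _)).trans_lt
      φ.rectifiable.hausdorffMeasure_range_lt_top)
  obtain ⟨U, hU, hinj⟩ := hφ.exists_injOn (G.edge e t)
  have hU' := (G.edge e).continuous.continuousAt hU
  -- On a loop both ends of `I` go to one point, so local injectivity in the graph does not give it
  -- in the parameter. Discarding an end `z` other than `t` cures this.
  have hne : ∃ z : I, t ≠ z ∧ (z = 0 ∨ z = 1) := by
    by_cases h : t = 0
    · exact ⟨1, by simp [h], Or.inr rfl⟩
    · exact ⟨0, h, Or.inl rfl⟩
  obtain ⟨z, htz, hz⟩ := hne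
  refine ⟨_, Filter.inter_mem hU' (isOpen_compl_singleton.mem_nhds htz), ?_⟩
  intro a ha b hb hab
  rcases edge_eq_edge (hinj ha.1 hb.1 hab) with h | ⟨h1, h2⟩
  · exact h.2
  · have haz : a ≠ z := ha.2
    have hbz : b ≠ z := hb.2
    rcases hz with rfl | rfl
    · rw [h1.resolve_left haz, h2.resolve_left hbz]
    · rw [h1.resolve_right haz, h2.resolve_right hbz]

end GraphFrechet

/-! ### The planar wave. -/

namespace GraphFrechet

open MultiGraph Set

section Wave

/-- A fast small circular motion, corrected to vanish at `0` and at `1`. -/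
noncomputable def wave (K ε x : ℝ) : ℂ :=
  ε * (Complex.exp ((K / ε * x : ℝ) * Complex.I) - 1 -
    x * (Complex.exp ((K / ε : ℝ) * Complex.I) - 1))

@[simp] theorem wave_zero (K ε : ℝ) : wave K ε 0 = 0 := by simp [wave]

@[simp] theorem wave_one (K ε : ℝ) : wave K ε 1 = 0 := by simp [wave]

@[simp] theorem wave_zero_left (K x : ℝ) : wave K 0 x = 0 := by simp [wave]

theorem norm_exp_mul_I_sub_one_le (x : ℝ) : ‖Complex.exp (x * Complex.I) - 1‖ ≤ 2 := by
  refine (norm_sub_le _ _).trans ?_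
  rw [Complex.norm_exp_ofReal_mul_I, norm_one]
  norm_num

/-- The bound does not involve the frequency `K / ε`. -/
theorem norm_wave_le (K ε x : ℝ) : ‖wave K ε x‖ ≤ |ε| * (2 + |x| * 2) := by
  rw [wave, norm_mul, Complex.norm_real, Real.norm_eq_abs]
  gcongr
  refine (norm_sub_le _ _).trans ?_
  rw [norm_mul, Complex.norm_real, Real.norm_eq_abs]
  gcongr
  exacts [norm_exp_mul_I_sub_one_le _, norm_exp_mul_I_sub_one_le _]

/-- At `ε = 0` the frequency blows up, but the amplitude squeezes the wave to zero. -/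
theorem continuous_wave (K : ℝ) : Continuous fun p : ℝ × ℝ => wave K p.1 p.2 := by
  rw [continuous_iff_continuousAt]
  rintro ⟨ε, x⟩
  by_cases hε : ε = 0
  · subst hε
    rw [ContinuousAt, wave_zero_left, tendsto_zero_iff_norm_tendsto_zero]
    have h : Filter.Tendsto (fun p : ℝ × ℝ => |p.1| * (2 + |p.2| * 2)) (𝓝 (0, x)) (𝓝 0) := by
      have : Continuous fun p : ℝ × ℝ => |p.1| * (2 + |p.2| * 2) := by fun_prop
      simpa using this.tendsto (0, x)
    exact squeeze_zero (fun _ => norm_nonneg _) (fun p => norm_wave_le K p.1 p.2) h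
  · unfold wave
    have h1 : ContinuousAt (fun p : ℝ × ℝ => K / p.1) (ε, x) :=
      continuousAt_const.div continuousAt_fst hε
    have h2 : ContinuousAt (fun p : ℝ × ℝ => K / p.1 * p.2) (ε, x) := h1.mul continuousAt_snd
    fun_prop

theorem hasStrictDerivAt_wave (K ε x : ℝ) :
    HasStrictDerivAt (wave K ε)
      (ε * ((K / ε : ℝ) * (Complex.exp ((K / ε * x : ℝ) * Complex.I) * Complex.I) -
        (Complex.exp ((K / ε : ℝ) * Complex.I) - 1))) x := by
  have h1 : HasStrictDerivAt (fun y : ℝ => ((K / ε * y : ℝ) : ℂ) * Complex.I)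
      ((K / ε : ℝ) * Complex.I) x := by
    refine ((Complex.ofRealCLM.hasStrictDerivAt (x := x)).mul_const
      ((K / ε : ℝ) * Complex.I)).congr_of_eventuallyEq ?_ |>.congr_deriv ?_
    · refine Filter.Eventually.of_forall fun y => ?_
      simp
      ring
    · simp
  have h2 := HasStrictDerivAt.const_mul (ε : ℂ) ((h1.cexp.sub_const 1).sub
    ((Complex.ofRealCLM.hasStrictDerivAt (x := x)).mul_const
      (Complex.exp ((K / ε : ℝ) * Complex.I) - 1)))
  refine h2.congr_deriv ?_
  simp only [Complex.ofRealCLM_apply, Complex.ofReal_one, one_mul]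
  ring

/-- Radius `ε` times frequency `K / ε` gives the rotation speed exactly `K`; the linear correction
contributes at most `2 * ε`. -/
theorem exists_hasStrictDerivAt_wave {K ε : ℝ} (hK : 0 ≤ K) (hε : 0 < ε) (x : ℝ) :
    ∃ D, HasStrictDerivAt (wave K ε) D x ∧ K - 2 * ε ≤ ‖D‖ ∧ ‖D‖ ≤ K + 2 * ε := by
  refine ⟨_, hasStrictDerivAt_wave K ε x, ?_⟩
  set A : ℂ := (ε : ℂ) * ((K / ε : ℝ) * (Complex.exp ((K / ε * x : ℝ) * Complex.I) * Complex.I))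
  set B : ℂ := (ε : ℂ) * (Complex.exp ((K / ε : ℝ) * Complex.I) - 1)
  have hA : ‖A‖ = K := by
    simp only [A, norm_mul, Complex.norm_real, Complex.norm_exp_ofReal_mul_I, Complex.norm_I,
      Real.norm_eq_abs, abs_of_pos hε, abs_of_nonneg (div_nonneg hK hε.le)]
    field_simp
  have hB : ‖B‖ ≤ 2 * ε := by
    simp only [B, norm_mul, Complex.norm_real, Real.norm_eq_abs, abs_of_pos hε]
    nlinarith [norm_exp_mul_I_sub_one_le (K / ε)]
  rw [mul_sub]
  have h1 := norm_sub_norm_le A B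
  have h2 := norm_sub_le A B
  constructor <;> linarith

theorem norm_wave_sub_le {K ε : ℝ} (hK : 0 ≤ K) (hε : 0 < ε) (x y : ℝ) :
    ‖wave K ε x - wave K ε y‖ ≤ (K + 2 * ε) * |x - y| := by
  have hd : Differentiable ℝ (wave K ε) := fun z =>
    (hasStrictDerivAt_wave K ε z).hasDerivAt.differentiableAt
  refine Convex.norm_image_sub_le_of_norm_deriv_le (s := univ) (fun z _ => hd z) (fun z _ => ?_)
    convex_univ (mem_univ y) (mem_univ x)
  obtain ⟨D, hD, -, h⟩ := exists_hasStrictDerivAt_wave hK hε z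
  rwa [hD.hasDerivAt.deriv]

end Wave

/-! ### Transverse directions and local injectivity of perturbations. -/

/-- Finitely many pairwise transverse directions in the plane. -/
theorem exists_directions (S : Type*) [Finite S] :
    ∃ (u : S → ℂ) (c B : ℝ), 0 < c ∧ c ≤ 1 ∧ 1 ≤ B ∧ (∀ i, 1 ≤ ‖u i‖ ∧ ‖u i‖ ≤ B) ∧
      ∀ i j, i ≠ j → ∀ x y : ℝ, 0 ≤ x → 0 ≤ y → c * (x + y) ≤ ‖u i * x - u j * y‖ := by
  obtain ⟨k, ⟨m⟩⟩ := Finite.exists_equiv_fin S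
  set M : ℝ := (k : ℝ)
  have hM : 0 ≤ M := Nat.cast_nonneg k
  have hm : ∀ i, ((m i : ℕ) : ℝ) ≤ M := fun i => Nat.cast_le.2 (m i).2.le
  have hm0 : ∀ i, (0 : ℝ) ≤ ((m i : ℕ) : ℝ) := fun i => Nat.cast_nonneg _
  -- Vectors of real part 1 with distinct integral slopes. As the slopes differ by at least 1, `x`
  -- and `y` are each at most `(1 + M) * ‖z‖`, whence the constant.
  refine ⟨fun i => ⟨1, (m i : ℕ)⟩, (2 * (1 + M))⁻¹, 1 + M, by positivity, ?_, by linarith,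
    fun i => ⟨?_, ?_⟩, fun i j hij x y hx hy => ?_⟩
  · exact inv_le_one_of_one_le₀ (by linarith)
  · simpa using Complex.abs_re_le_norm ⟨1, (m i : ℕ)⟩
  · refine (Complex.norm_le_abs_re_add_abs_im _).trans ?_
    simp only [abs_one, Nat.abs_cast]
    linarith [hm i]
  · rw [inv_mul_le_iff₀ (by positivity)]
    set z : ℂ := (⟨1, (m i : ℕ)⟩ : ℂ) * x - (⟨1, (m j : ℕ)⟩ : ℂ) * y with hz
    set p : ℝ := ((m i : ℕ) : ℝ)
    set q : ℝ := ((m j : ℕ) : ℝ)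
    have hre : |x - y| ≤ ‖z‖ := by simpa [hz] using Complex.abs_re_le_norm z
    have him : |p * x - q * y| ≤ ‖z‖ := by simpa [hz] using Complex.abs_im_le_norm z
    have hpq : 1 ≤ |q - p| := by
      have hne : ((m j : ℕ) : ℤ) - (m i : ℕ) ≠ 0 := by
        intro h
        exact hij (m.injective (Fin.ext (by omega)))
      have := Int.one_le_abs hne
      simpa [p, q] using (Int.cast_le (R := ℝ)).2 this
    have h1 : y ≤ (1 + p) * ‖z‖ := calc
      y ≤ |q - p| * y := le_mul_of_one_le_left hy hpq
      _ = |p * (x - y) - (p * x - q * y)| := by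
        rw [← abs_of_nonneg hy, ← abs_mul, abs_of_nonneg hy]; congr 1; ring
      _ ≤ |p * (x - y)| + |p * x - q * y| := abs_sub _ _
      _ ≤ p * ‖z‖ + ‖z‖ := by
        rw [abs_mul, abs_of_nonneg (hm0 i)]
        exact add_le_add (mul_le_mul_of_nonneg_left hre (hm0 i)) him
      _ = (1 + p) * ‖z‖ := by ring
    have h2 : x ≤ (1 + q) * ‖z‖ := calc
      x ≤ |q - p| * x := le_mul_of_one_le_left hx hpq
      _ = |q * (x - y) - (p * x - q * y)| := by
        rw [← abs_of_nonneg hx, ← abs_mul, abs_of_nonneg hx]; congr 1; ring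
      _ ≤ |q * (x - y)| + |p * x - q * y| := abs_sub _ _
      _ ≤ q * ‖z‖ + ‖z‖ := by
        rw [abs_mul, abs_of_nonneg (hm0 j)]
        exact add_le_add (mul_le_mul_of_nonneg_left hre (hm0 j)) him
      _ = (1 + q) * ‖z‖ := by ring
    have h3 := mul_le_mul_of_nonneg_right (hm i) (norm_nonneg z)
    have h4 := mul_le_mul_of_nonneg_right (hm j) (norm_nonneg z)
    nlinarith

section Charts

variable {X V S : Type*} [TopologicalSpace X] [T2Space X] [Finite V] [Finite S]
  {cv : V → X} {ce : S → C(I, X)}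

/-- Near `x`, every point other than `x` has a coordinate close to a coordinate of `x`. -/
theorem exists_nhds_charts (hcover : ∀ x, (∃ v, cv v = x) ∨ ∃ i ξ, ce i ξ = x) (x : X) {δ : ℝ}
    (hδ : 0 < δ) :
    ∃ U ∈ 𝓝 x, ∀ y ∈ U, y = x ∨ ∃ i ξ ξ₀, ce i ξ = y ∧ ce i ξ₀ = x ∧ dist ξ ξ₀ < δ := by
  -- The parameters far from every coordinate of `x`, which is all of `I` if the chart misses `x`.
  -- Their images and the other vertices form a closed set avoiding `x`.
  set Z : S → Set I := fun i => ⋂ ξ₀ ∈ {ξ₀ | ce i ξ₀ = x}, {ξ | δ ≤ dist ξ ξ₀} with hZ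
  have hZc : ∀ i, IsClosed (Z i) := fun i =>
    isClosed_biInter fun ξ₀ _ => isClosed_le continuous_const (by fun_prop)
  set A : Set X := (⋃ i, ce i '' Z i) ∪ (range cv \ {x}) with hA
  have hAc : IsClosed A := by
    refine IsClosed.union (isClosed_iUnion_of_finite fun i => ?_) ?_
    · exact ((hZc i).isCompact.image (ce i).continuous).isClosed
    · exact ((finite_range cv).subset sdiff_subset).isClosed
  have hx : x ∉ A := by
    rintro (h | h)
    · obtain ⟨i, ξ, hξ, rfl⟩ := mem_iUnion.1 h
      have : δ ≤ dist ξ ξ := mem_iInter₂.1 hξ ξ rfl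
      rw [dist_self] at this
      exact hδ.not_ge this
    · exact h.2 rfl
  refine ⟨Aᶜ, hAc.isOpen_compl.mem_nhds hx, fun y hy => ?_⟩
  rcases hcover y with ⟨v, rfl⟩ | ⟨i, ξ, rfl⟩
  · by_contra hne
    push Not at hne
    exact hy (Or.inr ⟨⟨v, rfl⟩, hne.1⟩)
  · by_contra hne
    push Not at hne
    refine hy (Or.inl (mem_iUnion.2 ⟨i, ξ, mem_iInter₂.2 fun ξ₀ h => ?_, rfl⟩))
    exact hne.2 i ξ ξ₀ rfl h

/-- A Lipschitz perturbation of a map that expands sufficiently along each chart, in transverse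
directions at the common points of different charts, is locally injective. -/
theorem exists_injOn_of_charts {F : Type*} [NormedAddCommGroup F] [NormedSpace ℝ F]
    (hcover : ∀ x, (∃ v, cv v = x) ∨ ∃ i ξ, ce i ξ = x)
    (hce : ∀ i j ξ η, ce i ξ = ce j η → ξ = η ∧ (i = j ∨ ξ = 0 ∨ ξ = 1))
    {f a : X → F} (J : ℂ →ₗᵢ[ℝ] F) {u : S → ℂ} {k : ℝ → ℂ} {c B L Λ : ℝ}
    (hk0 : k 0 = 0) (hk1 : k 1 = 0) (hk : ∀ x, ∃ D, HasStrictDerivAt k D x ∧ Λ ≤ ‖D‖)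
    (hf : ∀ i (ξ : I), f (ce i ξ) = a (ce i ξ) + J (u i * k ξ))
    (ha : ∀ i (ξ η : I), ‖a (ce i ξ) - a (ce i η)‖ ≤ L * |(ξ : ℝ) - η|)
    (hc0 : 0 < c) (hc1 : c ≤ 1) (hB : 1 ≤ B) (hu : ∀ i, 1 ≤ ‖u i‖ ∧ ‖u i‖ ≤ B)
    (hus : ∀ i j, i ≠ j → ∀ x y : ℝ, 0 ≤ x → 0 ≤ y → c * (x + y) ≤ ‖u i * x - u j * y‖)
    (hL : 0 ≤ L) (hΛ : L < Λ * c) (x : X) : ∃ U ∈ 𝓝 x, InjOn f U := by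
  by_cases hx : ∃ i ξ, ce i ξ = x
  swap
  -- A point outside every chart is isolated.
  · obtain ⟨U, hU, h⟩ := exists_nhds_charts hcover x one_pos
    refine ⟨U, hU, fun y hy z hz _ => ?_⟩
    have key : ∀ y ∈ U, y = x := fun y hy => (h y hy).resolve_right
      fun ⟨i, _, ξ₀, _, h, _⟩ => hx ⟨i, ξ₀, h⟩
    rw [key y hy, key z hz]
  obtain ⟨i₀, ξ₀, hi₀⟩ := hx
  obtain ⟨D, hD, hΛD⟩ := hk ξ₀
  -- The tolerated relative error in linearising `k`: scaled by a direction of norm at most `B`, it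
  -- costs at most half of the margin `Λ * c - L`.
  set κ := (Λ * c - L) / (2 * B) with hκ
  have hκ0 : 0 < κ := div_pos (by linarith) (by linarith)
  have hκB : κ * B = (Λ * c - L) / 2 := by rw [hκ]; field_simp
  have hΛ0 : 0 ≤ Λ := by
    by_contra h
    nlinarith
  have hbd : ∀ᶠ p : ℝ × ℝ in 𝓝 ((ξ₀ : ℝ), (ξ₀ : ℝ)), ‖k p.1 - k p.2 - (p.1 - p.2) • D‖ ≤
      κ * ‖p.1 - p.2‖ := by
    simpa using (hasStrictDerivAt_iff_hasStrictFDerivAt.1 hD).isLittleO.bound hκ0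
  rw [nhds_prod_eq] at hbd
  obtain ⟨t, ht, hbd⟩ := Filter.mem_prod_same_iff.1 hbd
  replace hbd : ∀ p ∈ t, ∀ q ∈ t, ‖k p - k q - (p - q) • D‖ ≤ κ * ‖p - q‖ :=
    fun p hp q hq => hbd (mk_mem_prod hp hq)
  obtain ⟨δ, hδ, hball⟩ := Metric.mem_nhds_iff.1 ht
  obtain ⟨U, hU, h⟩ := exists_nhds_charts hcover x hδ
  have hrep : ∀ y ∈ U, ∃ i, ∃ ξ : I, ce i ξ = y ∧ ce i ξ₀ = x ∧ (ξ : ℝ) ∈ t := by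
    intro y hy
    rcases h y hy with rfl | ⟨i, ξ, ξ₁, rfl, h1, hd⟩
    · exact ⟨i₀, ξ₀, hi₀, hi₀, mem_of_mem_nhds ht⟩
    -- All charts through `x` see it at the same parameter, so one derivative `D` serves them all.
    · have : ξ₁ = ξ₀ := (hce i i₀ ξ₁ ξ₀ (h1.trans hi₀.symm)).1
      subst this
      exact ⟨i, ξ, rfl, h1, hball hd⟩
  refine ⟨U, hU, fun y hy z hz hyz => ?_⟩
  obtain ⟨i, ξ, rfl, hiξ, hξ⟩ := hrep y hy
  obtain ⟨j, η, rfl, hjη, hη⟩ := hrep z hz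
  rw [hf, hf] at hyz
  have hdiff : ‖u i * k ξ - u j * k η‖ = ‖a (ce i ξ) - a (ce j η)‖ := by
    rw [← J.norm_map, map_sub, ← norm_neg]
    congr 1
    rw [neg_sub, sub_eq_sub_iff_add_eq_add, add_comm, ← hyz, add_comm]
  -- Within one chart `k` moves at rate at least `Λ - κ`, and `a` at rate at most `L`, which is too
  -- slow to compensate.
  by_cases hij : i = j
  · subst hij
    have h1 := hbd ξ hξ η hη
    rw [← mul_sub, norm_mul] at hdiff
    have h2 := ha i ξ η
    have h3 : ‖((ξ : ℝ) - η) • D‖ = |(ξ : ℝ) - η| * ‖D‖ := by rw [norm_smul, Real.norm_eq_abs]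
    have h4 := norm_sub_norm_le (((ξ : ℝ) - η) • D) (((ξ : ℝ) - η) • D - (k ξ - k η))
    rw [sub_sub_cancel, norm_sub_rev (((ξ : ℝ) - η) • D) (k ξ - k η), h3] at h4
    rw [Real.norm_eq_abs] at h1
    have h5 : ‖k ξ - k η‖ ≤ ‖u i‖ * ‖k ξ - k η‖ := le_mul_of_one_le_left (norm_nonneg _) (hu i).1
    have h6 : |(ξ : ℝ) - η| * Λ ≤ |(ξ : ℝ) - η| * ‖D‖ :=
      mul_le_mul_of_nonneg_left hΛD (abs_nonneg _)
    have h7 : |(ξ : ℝ) - η| * (Λ - κ - L) ≤ 0 := by nlinarith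
    have h8 : 0 < Λ - κ - L := by nlinarith
    have h9 : |(ξ : ℝ) - η| = 0 := le_antisymm (by nlinarith) (abs_nonneg _)
    have : ξ = η := Subtype.ext (sub_eq_zero.1 (abs_eq_zero.1 h9))
    rw [this]
  · have hend := (hce i j ξ₀ ξ₀ (hiξ.trans hjη.symm)).2.resolve_left hij
    have hk : k ξ₀ = 0 := by rcases hend with rfl | rfl <;> simpa
    have herr : ∀ ζ : I, (ζ : ℝ) ∈ t → ‖k ζ - ((ζ : ℝ) - ξ₀) • D‖ ≤ κ * |(ζ : ℝ) - ξ₀| := by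
      intro ζ hζ
      simpa [hk] using hbd ζ hζ ξ₀ (mem_of_mem_nhds ht)
    have hal : ‖a (ce i ξ) - a (ce j η)‖ ≤ L * |(ξ : ℝ) - ξ₀| + L * |(η : ℝ) - ξ₀| := by
      refine (norm_sub_le_norm_sub_add_norm_sub _ (a x) _).trans (add_le_add ?_ ?_)
      · rw [← hiξ]; exact ha i ξ ξ₀
      · rw [← hjη, norm_sub_rev]; exact ha j η ξ₀
    have hsep : c * (|(ξ : ℝ) - ξ₀| + |(η : ℝ) - ξ₀|) ≤
        ‖u i * ((ξ : ℝ) - ξ₀ : ℝ) - u j * ((η : ℝ) - ξ₀ : ℝ)‖ := by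
      rcases hend with rfl | rfl
      · simp only [Set.Icc.coe_zero, sub_zero, abs_of_nonneg ξ.2.1, abs_of_nonneg η.2.1]
        exact hus i j hij _ _ ξ.2.1 η.2.1
      -- At the end `1` both displacements are nonpositive, so transversality is applied to their
      -- negatives.
      · have hξ1 := sub_nonneg.2 ξ.2.2
        have hη1 := sub_nonneg.2 η.2.2
        rw [Set.Icc.coe_one, abs_sub_comm, abs_sub_comm (η : ℝ), abs_of_nonneg hξ1,
          abs_of_nonneg hη1, ← norm_neg]
        refine (hus i j hij _ _ hξ1 hη1).trans (le_of_eq (congrArg norm ?_))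
        push_cast
        ring
    -- With `D` factored out, transversality bounds the first term below by `Λ * c` times the total
    -- displacement; `L` and the linearisation errors absorb less.
    have hmain : u i * k ξ - u j * k η =
        D * (u i * ((ξ : ℝ) - ξ₀ : ℝ) - u j * ((η : ℝ) - ξ₀ : ℝ)) +
        (u i * (k ξ - ((ξ : ℝ) - ξ₀) • D) - u j * (k η - ((η : ℝ) - ξ₀) • D)) := by
      simp only [Complex.real_smul]
      ring
    set p := |(ξ : ℝ) - ξ₀|
    set q := |(η : ℝ) - ξ₀|
    have hp : 0 ≤ p := abs_nonneg _
    have hq : 0 ≤ q := abs_nonneg _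
    have e1 : ‖u i * (k ξ - ((ξ : ℝ) - ξ₀) • D)‖ ≤ B * (κ * p) := by
      rw [norm_mul]
      exact mul_le_mul (hu i).2 (herr ξ hξ) (norm_nonneg _) (by linarith)
    have e2 : ‖u j * (k η - ((η : ℝ) - ξ₀) • D)‖ ≤ B * (κ * q) := by
      rw [norm_mul]
      exact mul_le_mul (hu j).2 (herr η hη) (norm_nonneg _) (by linarith)
    have e3 := norm_sub_le (u i * (k ξ - ((ξ : ℝ) - ξ₀) • D)) (u j * (k η - ((η : ℝ) - ξ₀) • D))
    have e4 : Λ * (c * (p + q)) ≤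
        ‖D * (u i * ((ξ : ℝ) - ξ₀ : ℝ) - u j * ((η : ℝ) - ξ₀ : ℝ))‖ := by
      rw [norm_mul]
      exact mul_le_mul hΛD hsep (by positivity) (norm_nonneg _)
    have e5 := norm_sub_le_norm_add
      (D * (u i * ((ξ : ℝ) - ξ₀ : ℝ) - u j * ((η : ℝ) - ξ₀ : ℝ)))
      (u i * (k ξ - ((ξ : ℝ) - ξ₀) • D) - u j * (k η - ((η : ℝ) - ξ₀) • D))
    rw [← hmain, hdiff] at e5
    have e6 : (Λ * c - L) / 2 * (p + q) ≤ 0 := by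
      have : B * (κ * p) + B * (κ * q) = (Λ * c - L) / 2 * (p + q) := by rw [← hκB]; ring
      nlinarith
    have e7 : p + q ≤ 0 := by
      by_contra hpos
      nlinarith
    have hp0 : p = 0 := by linarith
    have hq0 : q = 0 := by linarith
    have h1 : ξ = ξ₀ := Subtype.ext (sub_eq_zero.1 (abs_eq_zero.1 hp0))
    have h2 : η = ξ₀ := Subtype.ext (sub_eq_zero.1 (abs_eq_zero.1 hq0))
    rw [h1, h2, hiξ, hjη]

end Charts

end GraphFrechet

/-! ### Half-edges and the homotopy in dimension at least two. -/

namespace GraphFrechet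

open MultiGraph Set

/-- The homothety of the unit interval onto its first half. -/
noncomputable def firstHalf : C(I, I) where
  toFun t := ⟨t / 2, by have := t.2.1; have := t.2.2; constructor <;> linarith⟩
  continuous_toFun := by fun_prop

@[simp] theorem coe_firstHalf (t : I) : (firstHalf t : ℝ) = t / 2 := rfl

namespace MultiGraph

variable {G : MultiGraph.{u}}

/-- The two halves of the edges, parametrised from an end vertex to the midpoint. The edge `e` is
parametrised by `G.edge e ∘ θ e`. -/
noncomputable def halfEdge (θ : G.E → I ≃ₜ I) (i : G.E × Bool) : C(I, G.Space) :=
  (G.edge i.1).comp ((θ i.1 : C(I, I)).comp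
    (if i.2 then (unitInterval.symmHomeomorph : C(I, I)).comp firstHalf else firstHalf))

theorem halfEdge_false (θ : G.E → I ≃ₜ I) (e : G.E) (t : I) :
    halfEdge θ (e, false) t = G.edge e (θ e (firstHalf t)) := rfl

theorem halfEdge_true (θ : G.E → I ≃ₜ I) (e : G.E) (t : I) :
    halfEdge θ (e, true) t = G.edge e (θ e (unitInterval.symm (firstHalf t))) := rfl

theorem exists_rep_halfEdge (θ : G.E → I ≃ₜ I) (x : G.Space) :
    (∃ v, G.vertex v = x) ∨ ∃ i t, halfEdge θ i t = x := by
  rcases exists_rep x with h | ⟨e, t, rfl⟩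
  · exact Or.inl h
  refine Or.inr ?_
  set r := (θ e).symm t with hr
  have hrt : θ e r = t := (θ e).apply_symm_apply t
  by_cases h : (r : ℝ) ≤ 1 / 2
  · refine ⟨(e, false), ⟨2 * r, by have := r.2.1; constructor <;> linarith⟩, ?_⟩
    rw [halfEdge_false, ← hrt]
    congr 2
    ext
    simp
  · refine ⟨(e, true), ⟨2 * (1 - r), by have := r.2.2; constructor <;> linarith⟩, ?_⟩
    rw [halfEdge_true, ← hrt]
    congr 2
    ext
    simp

/-- Different half-edges meet only at vertices, with parameter 0, or at midpoints, with parameter 1.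
Halving gives even the two ends of a loop separate charts with matching parameters. -/
theorem halfEdge_eq_halfEdge {θ : G.E → I ≃ₜ I} (h0 : ∀ e, θ e 0 = 0) (h1 : ∀ e, θ e 1 = 1)
    {i j : G.E × Bool} {ξ η : I} (h : halfEdge θ i ξ = halfEdge θ j η) :
    ξ = η ∧ (i = j ∨ ξ = 0 ∨ ξ = 1) := by
  have hrep : ∀ (e : G.E) (b : Bool) (ξ : I), ∃ r : I, halfEdge θ (e, b) ξ = G.edge e (θ e r) ∧
      (r : ℝ) = (if b then 1 - (ξ : ℝ) / 2 else (ξ : ℝ) / 2) := by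
    intro e b ξ
    cases b
    · exact ⟨firstHalf ξ, halfEdge_false θ e ξ, by simp⟩
    · exact ⟨unitInterval.symm (firstHalf ξ), halfEdge_true θ e ξ, by simp⟩
  have hend : ∀ (e : G.E) (b : Bool) (ξ r : I),
      (r : ℝ) = (if b then 1 - (ξ : ℝ) / 2 else (ξ : ℝ) / 2) → (θ e r = 0 ∨ θ e r = 1) → ξ = 0 := by
    intro e b ξ r hr h
    have hr' : r = 0 ∨ r = 1 := by
      rcases h with h | h
      · exact Or.inl ((θ e).injective (h.trans (h0 e).symm))
      · exact Or.inr ((θ e).injective (h.trans (h1 e).symm))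
    refine Subtype.ext ?_
    rw [Set.Icc.coe_zero]
    have h2 := ξ.2.1
    have h3 := ξ.2.2
    rcases hr' with rfl | rfl <;> cases b <;>
      simp only [Set.Icc.coe_zero, Set.Icc.coe_one, Bool.false_eq_true, if_true, if_false] at hr <;>
      linarith
  obtain ⟨e, b⟩ := i
  obtain ⟨e', b'⟩ := j
  obtain ⟨r, hr, hr'⟩ := hrep e b ξ
  obtain ⟨s, hs, hs'⟩ := hrep e' b' η
  rw [hr, hs] at h
  rcases edge_eq_edge h with ⟨rfl, hrs⟩ | ⟨hre, hse⟩
  · obtain rfl := (θ e).injective hrs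
    have h2 := ξ.2.2
    have h3 := η.2.2
    rw [hr'] at hs'
    have key : ∀ {ξ η : I}, (ξ : ℝ) / 2 = 1 - (η : ℝ) / 2 → ξ = η ∧ ξ = 1 := by
      intro ξ η h
      have h2 := ξ.2.2
      have h3 := η.2.2
      exact ⟨Subtype.ext (by linarith), Subtype.ext (by rw [Set.Icc.coe_one]; linarith)⟩
    cases b <;> cases b' <;> simp only [Bool.false_eq_true, if_true, if_false] at hs'
    · exact ⟨Subtype.ext (by linarith), Or.inl rfl⟩
    · exact ⟨(key hs').1, Or.inr (Or.inr (key hs').2)⟩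
    · obtain ⟨rfl, h1⟩ := key hs'.symm
      exact ⟨rfl, Or.inr (Or.inr h1)⟩
    · exact ⟨Subtype.ext (by linarith), Or.inl rfl⟩
  · obtain rfl := hend e b ξ r hr' hre
    exact ⟨(hend e' b' η s hs' hse).symm, Or.inr (Or.inl rfl)⟩

end MultiGraph

/-- Joint continuity on a graph can be checked on the vertices and on the edges. -/
theorem continuous_prod_of_edge {G : MultiGraph.{u}} {T Y : Type*} [TopologicalSpace T]
    [CompactSpace T] [T2Space T] [TopologicalSpace Y] {f : T × G.Space → Y}
    (hv : ∀ v, Continuous fun s => f (s, G.vertex v))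
    (he : ∀ e, Continuous fun p : T × I => f (p.1, G.edge e p.2)) : Continuous f := by
  -- A continuous surjection from a compact space to a Hausdorff one, hence a quotient map.
  let P : (Σ _ : G.V, T) ⊕ (Σ _ : G.E, T × I) → T × G.Space :=
    Sum.elim (fun q => (q.2, G.vertex q.1)) (fun q => (q.2.1, G.edge q.1 q.2.2))
  have hP : Continuous P := by
    refine Continuous.sumElim (continuous_sigma fun v => ?_) (continuous_sigma fun e => ?_)
    · exact continuous_id.prodMk (continuous_const (y := G.vertex v))
    · exact continuous_fst.prodMk ((G.edge e).continuous.comp continuous_snd)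
  have hs : Function.Surjective P := by
    rintro ⟨s, x⟩
    rcases exists_rep x with ⟨v, rfl⟩ | ⟨e, t, rfl⟩
    · exact ⟨Sum.inl ⟨v, s⟩, rfl⟩
    · exact ⟨Sum.inr ⟨e, s, t⟩, rfl⟩
  rw [(hP.isClosedMap.isQuotientMap hP hs).continuous_iff, continuous_sum_dom]
  exact ⟨continuous_sigma fun v => hv v, continuous_sigma fun e => he e⟩

/-- A map is rectifiable if a finite family of paths of finite length covers the graph. -/
theorem rectifiable_of_finite {n : ℕ} {G : MultiGraph.{u}}
    {φ : G.Space → EuclideanSpace ℝ (Fin n)} {ι : Type*} [Finite ι] (γ : ι → C(I, G.Space))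
    (hγ : ∀ x, ∃ i t, γ i t = x) (hv : ∀ i, eVariationOn (φ ∘ γ i) univ < ∞) :
    Rectifiable φ := by
  obtain ⟨k, ⟨m⟩⟩ := Finite.exists_equiv_fin ι
  refine ⟨k, fun i => γ (m.symm i), fun x => ?_, fun i => hv _⟩
  obtain ⟨i, t, h⟩ := hγ x
  exact ⟨m i, t, by simpa using h⟩

theorem eVariationOn_lt_top_of_lipschitz {E : Type*} [PseudoMetricSpace E] {f : I → E} {L : ℝ}
    (hf : ∀ s t : I, dist (f s) (f t) ≤ L * |(s : ℝ) - t|) : eVariationOn f univ < ∞ := by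
  have h : LipschitzWith L.toNNReal f := LipschitzWith.of_dist_le_mul fun s t =>
    (hf s t).trans (mul_le_mul_of_nonneg_right (Real.le_coe_toNNReal L) (abs_nonneg _))
  have hm : Monotone (Subtype.val : I → ℝ) := fun _ _ h => h
  have hb : BoundedVariationOn (Subtype.val : I → ℝ) univ :=
    (hm.monotoneOn _).boundedVariationOn (C := 1) fun x _ => by
      rw [abs_of_nonneg x.2.1]; exact x.2.2
  have hid : BoundedVariationOn (id : I → I) univ := hb
  exact lt_top_iff_ne_top.2 (h.comp_boundedVariationOn hid)

/-- An isometric copy of the plane in a Euclidean space of dimension at least two. -/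
theorem exists_linearIsometry_complex {n : ℕ} (hn : 2 ≤ n) :
    Nonempty (ℂ →ₗᵢ[ℝ] EuclideanSpace ℝ (Fin n)) := by
  let b := EuclideanSpace.basisFun (Fin n) ℝ
  let w : Fin 2 → EuclideanSpace ℝ (Fin n) := fun i => b (Fin.castLE hn i)
  have hw : Orthonormal ℝ w := b.orthonormal.comp _ (Fin.castLE_injective hn)
  let f : ℂ →ₗ[ℝ] EuclideanSpace ℝ (Fin n) := Complex.basisOneI.constr ℝ w
  refine ⟨f.isometryOfOrthonormal (v := Complex.basisOneI) ?_ ?_⟩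
  · rw [← Complex.toBasis_orthonormalBasisOneI]
    simp
  · convert hw
    ext1 i
    exact Complex.basisOneI.constr_basis ℝ w i

section Family

variable {G : MultiGraph.{u}} (θ : G.E → I ≃ₜ I) (u : G.E × Bool → ℂ) (K ε : ℝ)

/-- The wave `u i * wave K ε` on each half-edge `i`. -/
noncomputable def graphWave (h0 : ∀ e, θ e 0 = 0) (h1 : ∀ e, θ e 1 = 1) : C(G.Space, ℂ) :=
  lift (fun _ => 0)
    -- On the opposite half `min` freezes a wave at its end value `wave_one`, which is zero, so the
    -- summands never interfere.
    (fun e => ⟨fun t => u (e, false) * wave K ε (min (2 * ((θ e).symm t : ℝ)) 1) +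
      u (e, true) * wave K ε (min (2 * (1 - ((θ e).symm t : ℝ))) 1), by
        have hw : Continuous (wave K ε) := (continuous_wave K).comp (Continuous.prodMk_right ε)
        fun_prop⟩)
    (fun e => by
      have : (θ e).symm 0 = 0 := by rw [Homeomorph.symm_apply_eq, h0]
      simp [this])
    (fun e => by
      have : (θ e).symm 1 = 1 := by rw [Homeomorph.symm_apply_eq, h1]
      simp [this])

variable {θ} (h0 : ∀ e, θ e 0 = 0) (h1 : ∀ e, θ e 1 = 1)

theorem graphWave_halfEdge (i : G.E × Bool) (ξ : I) :
    graphWave θ u K ε h0 h1 (halfEdge θ i ξ) = u i * wave K ε ξ := by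
  obtain ⟨e, b⟩ := i
  have := ξ.2.2
  cases b
  · rw [halfEdge_false, graphWave, lift_edge]
    simp only [ContinuousMap.coe_mk, Homeomorph.symm_apply_apply, coe_firstHalf]
    rw [min_eq_left (by linarith), min_eq_right (by linarith), wave_one,
      mul_div_cancel₀ _ (two_ne_zero (α := ℝ))]
    simp
  · rw [halfEdge_true, graphWave, lift_edge]
    simp only [ContinuousMap.coe_mk, Homeomorph.symm_apply_apply, coe_firstHalf,
      unitInterval.coe_symm_eq]
    rw [min_eq_right (by linarith), min_eq_left (by linarith), wave_one, sub_sub_cancel,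
      mul_div_cancel₀ _ (two_ne_zero (α := ℝ))]
    simp

theorem continuous_graphWave {ε : I → ℝ} (hε : Continuous ε) :
    Continuous fun p : I × G.Space => graphWave θ u K (ε p.1) h0 h1 p.2 := by
  refine continuous_prod_of_edge (fun v => continuous_const) fun e => ?_
  have hw := continuous_wave K
  simp only [graphWave, lift_edge, ContinuousMap.coe_mk]
  have a1 : Continuous fun p : I × I => wave K (ε p.1) (min (2 * ((θ e).symm p.2 : ℝ)) 1) :=
    hw.comp (by fun_prop : Continuous fun p : I × I =>
      (ε p.1, min (2 * ((θ e).symm p.2 : ℝ)) 1))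
  have a2 : Continuous fun p : I × I => wave K (ε p.1) (min (2 * (1 - ((θ e).symm p.2 : ℝ))) 1) :=
    hw.comp (by fun_prop : Continuous fun p : I × I =>
      (ε p.1, min (2 * (1 - ((θ e).symm p.2 : ℝ))) 1))
  exact (continuous_const.mul a1).add (continuous_const.mul a2)

end Family

/-- Two maps that have finite length on every edge are the ends of a homotopy through rectifiable
maps whose intermediate maps are immersions. -/
theorem exists_immersion_homotopy {n : ℕ} (hn : 2 ≤ n) {G : MultiGraph.{u}} (φ ψ : RectMap n G)
    (hφ : ∀ e, BoundedVariationOn (φ.toMap ∘ G.edge e) univ)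
    (hψ : ∀ e, BoundedVariationOn (ψ.toMap ∘ G.edge e) univ) :
    ∃ Φ : I → RectMap n G, Φ 0 = φ ∧ Φ 1 = ψ ∧
      (Continuous fun p : I × G.Space => (Φ p.1).toMap p.2) ∧
      ∀ s, s ≠ 0 → s ≠ 1 → IsImmersion (Φ s).toMap := by
  obtain ⟨J⟩ := exists_linearIsometry_complex hn
  choose θ L₁ hL₁ h0 h1 hθφ hθψ using fun e => exists_lipschitz_reparam
    (φ.toMap.continuous.comp (G.edge e).continuous)
    (ψ.toMap.continuous.comp (G.edge e).continuous) (hφ e) (hψ e)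
  obtain ⟨L, hL⟩ : ∃ L, ∀ e, L₁ e ≤ L := by
    obtain ⟨L, hL⟩ := (finite_range L₁).bddAbove
    exact ⟨L, fun e => hL ⟨e, rfl⟩⟩
  set L' := max L 0 with hL'
  have hL'0 : 0 ≤ L' := le_max_right _ _
  obtain ⟨u, c, B, hc0, hc1, hB, hu, hus⟩ := exists_directions (G.E × Bool)
  have hlip : ∀ χ : RectMap n G, (∀ e (s t : I), dist (χ.toMap (G.edge e (θ e s)))
      (χ.toMap (G.edge e (θ e t))) ≤ L₁ e * |(s : ℝ) - t|) → ∀ i (ξ η : I),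
      ‖χ.toMap (halfEdge θ i ξ) - χ.toMap (halfEdge θ i η)‖ ≤ L' * |(ξ : ℝ) - η| := by
    rintro χ h ⟨e, b⟩ ξ η
    have hle : L₁ e * (|(ξ : ℝ) - η| / 2) ≤ L' * |(ξ : ℝ) - η| :=
      mul_le_mul ((hL e).trans (le_max_left _ _)) (half_le_self (abs_nonneg _)) (by positivity) hL'0
    rw [← dist_eq_norm]
    cases b
    · rw [halfEdge_false, halfEdge_false]
      refine (h _ _ _).trans (le_trans (le_of_eq ?_) hle)
      rw [coe_firstHalf, coe_firstHalf, ← sub_div, abs_div, abs_two]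
    · rw [halfEdge_true, halfEdge_true]
      refine (h _ _ _).trans (le_trans (le_of_eq ?_) hle)
      rw [unitInterval.coe_symm_eq, unitInterval.coe_symm_eq, coe_firstHalf, coe_firstHalf,
        sub_sub_sub_cancel_left, ← sub_div, abs_div, abs_two, abs_sub_comm]
  have hlφ := hlip φ hθφ
  have hlψ := hlip ψ hθψ
  -- Large enough that `(K - 2 * ε s) * c` exceeds `L'`, given `ε s ≤ 1 / 4`.
  set K : ℝ := (L' + 1) / c + 1 with hK
  have hK0 : 0 ≤ K := by positivity
  -- Vanishes exactly at the ends, where the homotopy must return `φ` and `ψ` unperturbed.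
  set ε : I → ℝ := fun s => s * (1 - s) with hε
  have hεc : Continuous ε := by fun_prop
  have hεpos : ∀ s : I, s ≠ 0 → s ≠ 1 → 0 < ε s := by
    intro s hs0 hs1
    exact lt_of_le_of_ne (mul_nonneg s.2.1 (sub_nonneg.2 s.2.2)) (mul_one_sub_ne_zero hs0 hs1).symm
  let A : I → C(G.Space, EuclideanSpace ℝ (Fin n)) := fun s =>
    (1 - (s : ℝ)) • φ.toMap + (s : ℝ) • ψ.toMap
  let W : I → C(G.Space, ℂ) := fun s => graphWave θ u K (ε s) h0 h1
  let F : I → C(G.Space, EuclideanSpace ℝ (Fin n)) := fun s =>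
    A s + (⟨J, J.continuous⟩ : C(ℂ, EuclideanSpace ℝ (Fin n))).comp (W s)
  have hA : ∀ s i (ξ η : I), ‖A s (halfEdge θ i ξ) - A s (halfEdge θ i η)‖ ≤
      L' * |(ξ : ℝ) - η| := by
    intro s i ξ η
    have e1 := hlφ i ξ η
    have e2 := hlψ i ξ η
    have hs0 := s.2.1
    have hs1 := sub_nonneg.2 s.2.2
    have : A s (halfEdge θ i ξ) - A s (halfEdge θ i η) =
        (1 - (s : ℝ)) • (φ.toMap (halfEdge θ i ξ) - φ.toMap (halfEdge θ i η)) +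
        (s : ℝ) • (ψ.toMap (halfEdge θ i ξ) - ψ.toMap (halfEdge θ i η)) := by
      simp only [A, ContinuousMap.add_apply, ContinuousMap.smul_apply, smul_sub]
      abel
    rw [this]
    refine (norm_add_le _ _).trans ?_
    rw [norm_smul, norm_smul, Real.norm_of_nonneg hs0, Real.norm_of_nonneg hs1]
    nlinarith
  have hF : ∀ s i (ξ : I), F s (halfEdge θ i ξ) =
      A s (halfEdge θ i ξ) + J (u i * wave K (ε s) ξ) := by
    intro s i ξ
    simp only [F, W, ContinuousMap.add_apply, ContinuousMap.comp_apply, ContinuousMap.coe_mk,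
      graphWave_halfEdge]
  have hW0 : ∀ x, graphWave θ u K 0 h0 h1 x = 0 := fun x => by
    rcases exists_rep_halfEdge θ x with ⟨v, rfl⟩ | ⟨i, t, rfl⟩
    · rfl
    · rw [graphWave_halfEdge, wave_zero_left, mul_zero]
  have hF0 : ∀ x, F 0 x = φ.toMap x := fun x => by
    simp [F, A, W, hε, hW0]
  have hF1 : ∀ x, F 1 x = ψ.toMap x := fun x => by
    simp [F, A, W, hε, hW0]
  have hrect : ∀ s, Rectifiable (F s) := by
    intro s
    by_cases hs0 : s = 0
    · subst hs0
      rw [funext hF0]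
      exact φ.rectifiable
    by_cases hs1 : s = 1
    · subst hs1
      rw [funext hF1]
      exact ψ.rectifiable
    refine rectifiable_of_finite (ι := G.V ⊕ (G.E × Bool))
      (Sum.elim (fun v => ContinuousMap.const I (G.vertex v)) (halfEdge θ)) (fun x => ?_) ?_
    · rcases exists_rep_halfEdge θ x with ⟨v, h⟩ | ⟨i, t, h⟩
      · exact ⟨Sum.inl v, 0, h⟩
      · exact ⟨Sum.inr i, t, h⟩
    · rintro (v | i)
      · refine eVariationOn_lt_top_of_lipschitz (L := 0) fun a b => ?_
        simp
      · refine eVariationOn_lt_top_of_lipschitz (L := L' + B * (K + 2 * ε s)) fun ξ η => ?_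
        simp only [Function.comp, Sum.elim_inr]
        rw [hF, hF, dist_eq_norm, add_sub_add_comm, ← map_sub J, ← mul_sub]
        refine (norm_add_le _ _).trans ?_
        rw [J.norm_map, norm_mul, add_mul, mul_assoc]
        exact add_le_add (hA s i ξ η) (mul_le_mul (hu i).2
          (norm_wave_sub_le hK0 (hεpos s hs0 hs1) ξ η) (norm_nonneg _) (by linarith))
  refine ⟨fun s => ⟨F s, hrect s⟩, ?_, ?_, ?_, fun s hs0 hs1 => ?_⟩
  · have : F 0 = φ.toMap := ContinuousMap.ext hF0
    simp only [this]
  · have : F 1 = ψ.toMap := ContinuousMap.ext hF1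
    simp only [this]
  · have hW := continuous_graphWave u K h0 h1 hεc
    have hJ := J.continuous
    have c1 : Continuous fun p : I × G.Space => A p.1 p.2 := by
      simp only [A, ContinuousMap.add_apply, ContinuousMap.smul_apply]
      fun_prop
    exact c1.add (hJ.comp hW)
  · have hε1 : ε s ≤ 1 / 4 := by
      simp only [hε]
      nlinarith [sq_nonneg ((s : ℝ) - 1 / 2)]
    refine isImmersion_of_injOn (F s).continuous fun x => ?_
    refine exists_injOn_of_charts (exists_rep_halfEdge θ)
      (fun i j ξ η h => halfEdge_eq_halfEdge h0 h1 h) J (k := wave K (ε s)) (Λ := K - 2 * ε s)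
      (wave_zero _ _) (wave_one _ _) (fun y => ?_) (hF s) (hA s) hc0 hc1 hB hu hus hL'0 ?_ x
    · obtain ⟨D, hD, h, -⟩ := exists_hasStrictDerivAt_wave hK0 (hεpos s hs0 hs1) y
      exact ⟨D, hD, h⟩
    · have : (L' + 1) / c * c = L' + 1 := by field_simp
      rw [hK]
      nlinarith

end GraphFrechet

/-! ### Locally injective functions to the line. -/

namespace GraphFrechet

open MultiGraph Set

theorem image_connectedComponent_eq_Icc {X : Type*} [TopologicalSpace X] [CompactSpace X] {f : X → ℝ} (hf : Continuous f) (x : X) :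
    f '' connectedComponent x =
      Icc (sInf (f '' connectedComponent x)) (sSup (f '' connectedComponent x)) :=
  eq_Icc_of_connected_compact (isConnected_connectedComponent.image f hf.continuousOn)
    (isClosed_connectedComponent.isCompact.image hf)

/-- Components are open here, so coefficients chosen per component vary continuously. -/
theorem isLocallyConstant_of_connectedComponent {X Y : Type*} [TopologicalSpace X]
    [LocallyConnectedSpace X] (F : Set X → Y) :
    IsLocallyConstant fun x : X => F (connectedComponent x) :=
  IsLocallyConstant.of_constant_on_connected_components fun x y hy => by
    rw [connectedComponent_eq hy]

section Line

variable {X : Type*} [TopologicalSpace X] [T2Space X]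

/-- Two compact connected sets with a common point on which a locally injective real function is
injective have a union on which it is injective. -/
theorem injOn_union_of_locally_injOn {f : X → ℝ} (hf : Continuous f)
    (hinj : ∀ x, ∃ U ∈ 𝓝 x, InjOn f U) {K L : Set X} (hK : IsCompact K) (hL : IsCompact L)
    (hKc : IsPreconnected K) (hLc : IsPreconnected L) (hKi : InjOn f K) (hLi : InjOn f L)
    (hKL : (K ∩ L).Nonempty) : InjOn f (K ∪ L) := by
  -- `J` is an interval, and `T` is nonempty, closed, and open relative to `J`. Hence `T = J`: a
  -- value taken on both sets is taken at a common point.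
  set J := f '' K ∩ f '' L with hJ
  have hJc : IsPreconnected J :=
    ((hKc.image f hf.continuousOn).ordConnected.inter
      (hLc.image f hf.continuousOn).ordConnected).isPreconnected
  set T := f '' (K ∩ L) with hT
  have hTc : IsClosed T := ((hK.inter_right hL.isClosed).image hf).isClosed
  set O := {r | ∀ᶠ s in 𝓝 r, s ∈ J → s ∈ T} with hO
  have hOo : IsOpen O := isOpen_setOfPred_eventually_nhds
  have hTO : T ⊆ O := by
    rintro _ ⟨a, ⟨haK, haL⟩, rfl⟩
    obtain ⟨U, hU, hUi⟩ := hinj a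
    -- By compactness and injectivity on `C`, values close to `f a` are taken on `C` only inside
    -- `U`.
    have hcl : ∀ C : Set X, IsCompact C → InjOn f C → a ∈ C →
        ∀ᶠ s in 𝓝 (f a), s ∉ f '' (C \ interior U) := by
      intro C hC hCi haC
      refine ((hC.diff isOpen_interior).image hf).isClosed.isOpen_compl.mem_nhds ?_
      rintro ⟨b, hb, hba⟩
      have := hCi hb.1 haC hba
      subst this
      exact hb.2 (mem_interior_iff_mem_nhds.2 hU)
    filter_upwards [hcl K hK hKi haK, hcl L hL hLi haL] with s h1 h2 hs
    obtain ⟨⟨p, hp, hps⟩, ⟨q, hq, hqs⟩⟩ := hs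
    have hpU : p ∈ interior U := by
      by_contra h
      exact h1 ⟨p, ⟨hp, h⟩, hps⟩
    have hqU : q ∈ interior U := by
      by_contra h
      exact h2 ⟨q, ⟨hq, h⟩, hqs⟩
    have := hUi (interior_subset hpU) (interior_subset hqU) (hps.trans hqs.symm)
    subst this
    exact ⟨p, ⟨hp, hq⟩, hps⟩
  have hJT : J ⊆ T := by
    by_contra h
    obtain ⟨r, hrJ, hrT⟩ := not_subset.1 h
    obtain ⟨a, ha⟩ := hKL
    obtain ⟨s, hsJ, hsO, hsT⟩ := hJc O Tᶜ hOo hTc.isOpen_compl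
      (fun s _ => (em (s ∈ T)).imp (fun h => hTO h) id)
      ⟨f a, ⟨⟨a, ha.1, rfl⟩, ⟨a, ha.2, rfl⟩⟩, hTO ⟨a, ha, rfl⟩⟩ ⟨r, hrJ, hrT⟩
    exact hsT (hsO.self_of_nhds hsJ)
  have key : ∀ p ∈ K, ∀ q ∈ L, f p = f q → p = q := by
    intro p hp q hq hpq
    obtain ⟨a, ha, hap⟩ := hJT ⟨⟨p, hp, rfl⟩, ⟨q, hq, hpq.symm⟩⟩
    exact (hKi hp ha.1 hap.symm).trans (hLi ha.2 hq (hap.trans hpq))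
  rintro p (hp | hp) q (hq | hq) hpq
  · exact hKi hp hq hpq
  · exact key p hp q hq hpq
  · exact (key q hq p hp hpq.symm).symm
  · exact hLi hp hq hpq

/-- Two continuous real functions that are injective on the components and have the same values on
each of them differ by a homeomorphism. -/
theorem exists_homeomorph_of_image_eq [CompactSpace X] {f g : X → ℝ} (hf : Continuous f) (hg : Continuous g)
    (hfi : ∀ x, InjOn f (connectedComponent x)) (hgi : ∀ x, InjOn g (connectedComponent x))
    (h : ∀ x, f '' connectedComponent x = g '' connectedComponent x) :
    ∃ k : X ≃ₜ X, ∀ x, f x = g (k x) := by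
  -- Component and value together embed `X`, and embeddings with equal range differ by a
  -- homeomorphism. Only ranges matter, so the homeomorphism may reverse a component.
  let P : (X → ℝ) → X → ConnectedComponents X × ℝ := fun f x => (x, f x)
  have hemb : ∀ f, Continuous f → (∀ x, InjOn f (connectedComponent x)) → IsEmbedding (P f) := by
    intro f hf hfi
    refine (Continuous.isClosedEmbedding
      (ConnectedComponents.continuous_coe.prodMk hf) fun x y hxy => ?_).isEmbedding
    obtain ⟨h1, h2⟩ := Prod.mk.inj hxy
    refine hfi y ?_ mem_connectedComponent h2
    rw [← ConnectedComponents.coe_eq_coe.1 h1]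
    exact mem_connectedComponent
  have hsub : ∀ f g : X → ℝ, (∀ x, f '' connectedComponent x ⊆ g '' connectedComponent x) →
      range (P f) ⊆ range (P g) := by
    rintro f g h _ ⟨x, rfl⟩
    obtain ⟨y, hy, hyx⟩ := h x ⟨x, mem_connectedComponent, rfl⟩
    exact ⟨y, Prod.ext (ConnectedComponents.coe_eq_coe.2 (connectedComponent_eq hy).symm) hyx⟩
  have hr : range (P f) = range (P g) :=
    (hsub f g fun x => (h x).subset).antisymm (hsub g f fun x => (h x).superset)
  let kf := (hemb f hf hfi).toHomeomorph
  let kg := (hemb g hg hgi).toHomeomorph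
  refine ⟨(kf.trans (Homeomorph.setCongr hr)).trans kg.symm, fun x => ?_⟩
  have : kg (((kf.trans (Homeomorph.setCongr hr)).trans kg.symm) x) = Homeomorph.setCongr hr (kf x) :=
    kg.apply_symm_apply _
  exact (congrArg (fun p => p.1.2) this).symm

variable [CompactSpace X] [LocallyConnectedSpace X]

/-- A locally injective real function is injective on every connected component. -/
theorem injOn_connectedComponent_of_locally_injOn {f : X → ℝ} (hf : Continuous f)
    (hinj : ∀ x, ∃ U ∈ 𝓝 x, InjOn f U) (x : X) : InjOn f (connectedComponent x) := by
  -- Gluing makes `R` transitive and local connectedness makes it hold nearby; its classes are thus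
  -- clopen and contain the components.
  let R : X → X → Prop := fun x y =>
    ∃ K, IsCompact K ∧ IsPreconnected K ∧ InjOn f K ∧ x ∈ K ∧ y ∈ K
  have hsymm : ∀ {x y}, R x y → R y x := fun ⟨K, h1, h2, h3, h4, h5⟩ => ⟨K, h1, h2, h3, h5, h4⟩
  have htrans : ∀ {x y z}, R x y → R y z → R x z := by
    rintro x y z ⟨K, h1, h2, h3, h4, h5⟩ ⟨L, k1, k2, k3, k4, k5⟩
    exact ⟨K ∪ L, h1.union k1, h2.union y h5 k4 k2,
      injOn_union_of_locally_injOn hf hinj h1 k1 h2 k2 h3 k3 ⟨y, h5, k4⟩, Or.inl h4, Or.inr k5⟩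
  have hloc : ∀ x, ∀ᶠ y in 𝓝 x, R x y := by
    intro x
    obtain ⟨U, hU, hUi⟩ := hinj x
    obtain ⟨K, hK, hKU, hKc⟩ := local_compact_nhds hU
    obtain ⟨C, hC, hCc, hCK⟩ := locallyConnectedSpace_iff_connected_subsets.1 ‹_› x K hK
    have hsub : closure C ⊆ K := closure_minimal hCK hKc.isClosed
    filter_upwards [hC] with y hy
    exact ⟨closure C, hKc.of_isClosed_subset isClosed_closure hsub, hCc.closure,
      hUi.mono (hsub.trans hKU), subset_closure (mem_of_mem_nhds hC), subset_closure hy⟩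
  have hclopen : IsClopen {y | R x y} := by
    refine ⟨⟨isOpen_iff_mem_nhds.2 fun y hy => ?_⟩, isOpen_iff_mem_nhds.2 fun y hy => ?_⟩
    · filter_upwards [hloc y] with z hz h
      exact hy (htrans h (hsymm hz))
    · filter_upwards [hloc y] with z hz
      exact htrans hy hz
  have hsub : connectedComponent x ⊆ {y | R x y} :=
    hclopen.connectedComponent_subset (hloc x).self_of_nhds
  intro y hy z hz hyz
  obtain ⟨K, -, -, hKi, hyK, hzK⟩ := htrans (hsymm (hsub hy)) (hsub hz)
  exact hKi hyK hzK hyz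

/-- Locally injective real functions agree up to a homeomorphism and up to increasing affine maps
on the components. -/
theorem exists_homeomorph_affine {f g : X → ℝ} (hf : Continuous f) (hg : Continuous g)
    (hfi : ∀ x, ∃ U ∈ 𝓝 x, InjOn f U) (hgi : ∀ x, ∃ U ∈ 𝓝 x, InjOn g U) :
    ∃ (r b : X → ℝ) (k : X ≃ₜ X), IsLocallyConstant r ∧ IsLocallyConstant b ∧ (∀ x, 0 < r x) ∧
      ∀ x, r x * f x + b x = g (k x) := by
  have hfc := injOn_connectedComponent_of_locally_injOn hf hfi
  have hgc := injOn_connectedComponent_of_locally_injOn hg hgi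
  let m : (X → ℝ) → Set X → ℝ := fun f C => sInf (f '' C)
  let M : (X → ℝ) → Set X → ℝ := fun f C => sSup (f '' C)
  have hIcc : ∀ f, Continuous f → ∀ x, f '' connectedComponent x =
    Icc (m f (connectedComponent x)) (M f (connectedComponent x)) :=
      fun f hf x => image_connectedComponent_eq_Icc hf x
  have hlt : ∀ f g : X → ℝ, Continuous f → Continuous g → (∀ x, InjOn g (connectedComponent x)) →
      ∀ x, m f (connectedComponent x) < M f (connectedComponent x) →
        m g (connectedComponent x) < M g (connectedComponent x) := by
    intro f g hf hg hgc x h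
    have h1 := hIcc f hf x
    obtain ⟨y, hy, hym⟩ := h1.symm.subset (left_mem_Icc.2 h.le)
    obtain ⟨z, hz, hzM⟩ := h1.symm.subset (right_mem_Icc.2 h.le)
    have hyz : g y ≠ g z := fun he => by
      have := hgc x hy hz he
      subst this
      exact h.ne (hym.symm.trans hzM)
    have h2 := (hIcc g hg x).subset ⟨y, hy, rfl⟩
    have h3 := (hIcc g hg x).subset ⟨z, hz, rfl⟩
    rcases hyz.lt_or_gt with h | h
    · exact h2.1.trans_lt (h.trans_le h3.2)
    · exact h3.1.trans_lt (h.trans_le h2.2)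
  have hle : ∀ f, Continuous f → ∀ x, m f (connectedComponent x) ≤ M f (connectedComponent x) := by
    intro f hf x
    have := (hIcc f hf x).subset ⟨x, mem_connectedComponent, rfl⟩
    exact this.1.trans this.2
  -- The ratio of the lengths of the image intervals. By `hlt` both intervals degenerate together,
  -- and then any positive value, such as 1, will do.
  let r : Set X → ℝ := fun C => if m f C < M f C then (M g C - m g C) / (M f C - m f C) else 1
  let b : Set X → ℝ := fun C => m g C - r C * m f C
  have hr : ∀ x, 0 < r (connectedComponent x) := by
    intro x
    simp only [r]
    split_ifs with h
    · exact div_pos (sub_pos.2 (hlt f g hf hg hgc x h)) (sub_pos.2 h)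
    · exact one_pos
  have hrM : ∀ x, r (connectedComponent x) * (M f (connectedComponent x) -
      m f (connectedComponent x)) = M g (connectedComponent x) - m g (connectedComponent x) := by
    intro x
    simp only [r]
    split_ifs with h
    · exact div_mul_cancel₀ _ (sub_pos.2 h).ne'
    · have h1 := (hle f hf x).antisymm (not_lt.1 h)
      have h2 := (hle g hg x).antisymm (not_lt.1 fun h' => h (hlt g f hg hf hfc x h'))
      rw [← h1, ← h2, sub_self, sub_self, mul_zero]
  set A : X → ℝ := fun x => r (connectedComponent x) * f x + b (connectedComponent x) with hA
  have hrl : IsLocallyConstant fun x => r (connectedComponent x) :=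
    isLocallyConstant_of_connectedComponent r
  have hbl : IsLocallyConstant fun x => b (connectedComponent x) :=
    isLocallyConstant_of_connectedComponent b
  have hAc : Continuous A := (hrl.continuous.mul hf).add hbl.continuous
  have hAx : ∀ x, ∀ y ∈ connectedComponent x,
      A y = r (connectedComponent x) * f y + b (connectedComponent x) := fun x y hy => by
    simp only [hA]
    rw [connectedComponent_eq hy]
  have hAi : ∀ x, InjOn A (connectedComponent x) := by
    intro x y hy z hz hyz
    rw [hAx x y hy, hAx x z hz, add_left_inj] at hyz
    exact hfc x hy hz (mul_left_cancel₀ (hr x).ne' hyz)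
  obtain ⟨k, hk⟩ := exists_homeomorph_of_image_eq hAc hg hAi hgc fun x => by
    have h1 := hr x
    have h2 := hrM x
    rw [hIcc g hg x]
    ext t
    constructor
    · rintro ⟨y, hy, rfl⟩
      rw [hAx x y hy]
      obtain ⟨h3, h4⟩ := (hIcc f hf x).subset ⟨y, hy, rfl⟩
      simp only [b]
      constructor <;> nlinarith
    · rintro ⟨h3, h4⟩
      have : (t - b (connectedComponent x)) / r (connectedComponent x) ∈
          f '' connectedComponent x := by
        rw [hIcc f hf x]
        refine ⟨(le_div_iff₀ h1).2 ?_, (div_le_iff₀ h1).2 ?_⟩ <;> simp only [b] <;> nlinarith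
      obtain ⟨y, hy, hyt⟩ := this
      refine ⟨y, hy, ?_⟩
      rw [hAx x y hy, hyt, mul_div_cancel₀ _ h1.ne', sub_add_cancel]
  exact ⟨_, _, k, hrl, hbl, hr, hk⟩

end Line

/-- In dimension one, immersions of the same graph are homotopic through immersions, up to a
reparametrisation of one of them. -/
theorem exists_immersion_homotopy_line {G : MultiGraph.{u}} (φ ψ : RectMap 1 G)
    (hφ : IsImmersion φ.toMap) (hψ : IsImmersion ψ.toMap) :
    ∃ (Φ : I → RectMap 1 G) (k : G.Space ≃ₜ G.Space), Φ 0 = φ ∧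
      (∀ x, (Φ 1).toMap x = ψ.toMap (k x)) ∧
      (Continuous fun p : I × G.Space => (Φ p.1).toMap p.2) ∧
      ∀ s, IsImmersion (Φ s).toMap := by
  have hcoord : ∀ p q : EuclideanSpace ℝ (Fin 1), p 0 = q 0 → p = q := fun p q h => by
    ext i
    rwa [Subsingleton.elim i 0]
  have hloc : ∀ χ : RectMap 1 G, IsImmersion χ.toMap → ∀ x, ∃ U ∈ 𝓝 x,
      InjOn (fun x => χ.toMap x 0) U := by
    intro χ hχ x
    obtain ⟨U, hU, h⟩ := hχ.exists_injOn x
    exact ⟨U, hU, fun a ha b hb hab => h ha hb (hcoord _ _ hab)⟩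
  have hcont : ∀ χ : RectMap 1 G, Continuous fun x => χ.toMap x 0 := fun χ => by fun_prop
  obtain ⟨r, b, k, hr, hb, hr0, hk⟩ := exists_homeomorph_affine (hcont φ) (hcont ψ)
    (hloc φ hφ) (hloc ψ hψ)
  let β : G.Space → EuclideanSpace ℝ (Fin 1) := fun x => EuclideanSpace.single 0 (b x)
  have hβ : IsLocallyConstant β := hb.comp (EuclideanSpace.single 0)
  have hrc := hr.continuous
  have hβc := hβ.continuous
  -- Linear interpolation between `φ` and `r • φ + β`, which is `ψ ∘ k`; positivity of `r` keeps the
  -- coefficient of `φ` positive throughout.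
  let F : I → C(G.Space, EuclideanSpace ℝ (Fin 1)) := fun s =>
    ⟨fun x => (1 - (s : ℝ) + s * r x) • φ.toMap x + (s : ℝ) • β x, by fun_prop⟩
  have hpos : ∀ (s : I) x, 0 < 1 - (s : ℝ) + s * r x := by
    intro s x
    rcases s.2.1.eq_or_lt with h | h
    · rw [← h]; simp
    · have := mul_pos h (hr0 x)
      linarith [s.2.2]
  have hrect : ∀ s, Rectifiable (F s) := by
    intro s
    obtain ⟨m, γ, hγ, hv⟩ := φ.rectifiable
    refine ⟨m, γ, hγ, fun i => ?_⟩
    have h1 : ∀ t, r (γ i t) = r (γ i 0) := fun t =>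
      (hr.comp_continuous (γ i).continuous).apply_eq_of_preconnectedSpace t 0
    have h2 : ∀ t, β (γ i t) = β (γ i 0) := fun t =>
      (hβ.comp_continuous (γ i).continuous).apply_eq_of_preconnectedSpace t 0
    have hlip : LipschitzWith (1 - (s : ℝ) + s * r (γ i 0)).toNNReal
        fun p : EuclideanSpace ℝ (Fin 1) =>
          (1 - (s : ℝ) + s * r (γ i 0)) • p + (s : ℝ) • β (γ i 0) := by
      refine LipschitzWith.of_dist_le_mul fun p q => ?_
      rw [dist_add_right, dist_smul₀, Real.coe_toNNReal _ (hpos s _).le,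
        Real.norm_of_nonneg (hpos s _).le]
    have := hlip.comp_boundedVariationOn (f := fun p : EuclideanSpace ℝ (Fin 1) =>
          (1 - (s : ℝ) + s * r (γ i 0)) • p + (s : ℝ) • β (γ i 0)) (hv i).ne
    refine lt_top_iff_ne_top.2 ?_
    refine ne_of_eq_of_ne (congrArg (fun f => eVariationOn f univ) (funext fun t => ?_)) this
    simp only [F, Function.comp, ContinuousMap.coe_mk, h1 t, h2 t]
  refine ⟨fun s => ⟨F s, hrect s⟩, k, ?_, fun x => hcoord _ _ ?_, ?_, fun s => ?_⟩
  · have : F 0 = φ.toMap := by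
      ext1 x
      simp [F]
    simp only [this]
  · rw [← hk]
    simp [F, β]
  · simp only [F, ContinuousMap.coe_mk]
    fun_prop
  · refine isImmersion_of_injOn (F s).continuous fun x => ?_
    obtain ⟨U, hU, hUi⟩ := hφ.exists_injOn x
    refine ⟨U ∩ ({y | r y = r x} ∩ {y | β y = β x}), Filter.inter_mem hU (Filter.inter_mem
      ((hr.isOpen_fiber _).mem_nhds rfl) ((hβ.isOpen_fiber _).mem_nhds rfl)), ?_⟩
    rintro y ⟨hy, hry, hby⟩ z ⟨hz, hrz, hbz⟩ hyz
    simp only [mem_ofPred_eq] at hry hby hrz hbz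
    simp only [F, ContinuousMap.coe_mk, hry, hby, hrz, hbz, add_left_inj] at hyz
    exact hUi hy hz (smul_right_injective _ (hpos s x).ne' hyz)

end GraphFrechet

/-! ### Paths of immersions and connected components. -/

namespace GraphFrechet

open MultiGraph

/-- Two immersions of the same graph are the ends, up to Fréchet distance zero, of a continuous
family of immersions. -/
theorem exists_path_of_immersions {n : ℕ} {G : MultiGraph.{u}} {φ ψ : RectMap n G}
    (hφ : IsImmersion φ.toMap) (hψ : IsImmersion ψ.toMap) :
    ∃ Φ : I → RectMap n G, Continuous Φ ∧ (∀ s, IsImmersion (Φ s).toMap) ∧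
      edist (Φ 0) φ = 0 ∧ edist (Φ 1) ψ = 0 := by
  obtain rfl | rfl | hn : n = 0 ∨ n = 1 ∨ 2 ≤ n := by omega
  · refine ⟨fun _ => φ, continuous_const, fun _ => hφ, edist_self _, ?_⟩
    exact GraphMap.edist_eq_zero_of_comp (p := ⟨G, φ⟩) (q := ⟨G, ψ⟩) (Homeomorph.refl _)
      fun x => Subsingleton.elim _ _
  · obtain ⟨Φ, k, h0, h1, hc, hi⟩ := exists_immersion_homotopy_line φ ψ hφ hψ
    refine ⟨Φ, RectMap.continuous_of_uncurry hc, hi, by rw [h0, edist_self], ?_⟩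
    exact GraphMap.edist_eq_zero_of_comp (p := ⟨G, Φ 1⟩) (q := ⟨G, ψ⟩) k h1
  · obtain ⟨Φ, h0, h1, hc, hi⟩ := exists_immersion_homotopy hn φ ψ
      (φ.boundedVariationOn_edge hφ) (ψ.boundedVariationOn_edge hψ)
    refine ⟨Φ, RectMap.continuous_of_uncurry hc, fun s => ?_, by rw [h0, edist_self],
      by rw [h1, edist_self]⟩
    by_cases hs0 : s = 0
    · rwa [hs0, h0]
    by_cases hs1 : s = 1
    · rwa [hs1, h1]
    exact hi s hs0 hs1

theorem joined_immersions {n : ℕ} {G : MultiGraph.{u}} (x y : immersions n G) : Joined x y := by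
  obtain ⟨_, φ, hφ, rfl⟩ := x
  obtain ⟨_, ψ, hψ, rfl⟩ := y
  obtain ⟨Φ, hc, hi, h0, h1⟩ := exists_path_of_immersions hφ hψ
  exact ⟨⟨⟨fun s => ⟨SeparationQuotient.mk (Φ s), Φ s, hi s, rfl⟩,
    (SeparationQuotient.continuous_mk.comp hc).subtype_mk _⟩,
    Subtype.ext (SeparationQuotient.mk_eq_mk.2 (EMetric.inseparable_iff.2 h0)),
    Subtype.ext (SeparationQuotient.mk_eq_mk.2 (EMetric.inseparable_iff.2 h1))⟩⟩

theorem isometry_graphMap_mk (n : ℕ) (G : MultiGraph.{u}) :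
    Isometry fun φ : RectMap n G => (⟨G, φ⟩ : GraphMap.{u} n) := fun _ _ => rfl

theorem joined_immersedPair {n : ℕ} {G : MultiGraph.{u}} {φ ψ : RectMap n G}
    (hφ : IsImmersion φ.toMap) (hψ : IsImmersion ψ.toMap) :
    Joined (immersedPair G φ hφ) (immersedPair G ψ hψ) := by
  obtain ⟨Φ, hc, hi, h0, h1⟩ := exists_path_of_immersions hφ hψ
  exact ⟨⟨⟨fun s => immersedPair G (Φ s) (hi s), (SeparationQuotient.continuous_mk.comp
    ((isometry_graphMap_mk n G).continuous.comp hc)).subtype_mk _⟩,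
    Subtype.ext (SeparationQuotient.mk_eq_mk.2 (EMetric.inseparable_iff.2 h0)),
    Subtype.ext (SeparationQuotient.mk_eq_mk.2 (EMetric.inseparable_iff.2 h1))⟩⟩

/-- Reparametrising by a homeomorphism of graphs does not change the point. -/
theorem immersedPair_comp {n : ℕ} {G H : MultiGraph.{u}} (k : G.Space ≃ₜ H.Space)
    {ψ : RectMap n H} (hψ : IsImmersion ψ.toMap) (h : IsImmersion (ψ.comp k).toMap) :
    immersedPair G (ψ.comp k) h = immersedPair H ψ hψ :=
  Subtype.ext (SeparationQuotient.mk_eq_mk.2 (EMetric.inseparable_iff.2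
    (GraphMap.edist_eq_zero_of_comp (p := ⟨G, ψ.comp k⟩) (q := ⟨H, ψ⟩) k fun _ => rfl)))

/-- Every graph can be immersed in a Euclidean space of dimension at least two. -/
theorem exists_immersion {n : ℕ} (hn : 2 ≤ n) (G : MultiGraph.{u}) :
    ∃ φ : RectMap n G, IsImmersion φ.toMap := by
  -- The zero map has edges of length zero, and the homotopy from it to itself passes through
  -- immersions; its middle map is taken.
  let φ : RectMap n G := ⟨0, rectifiable_of_finite (ι := G.V ⊕ G.E)
    (Sum.elim (fun v => ContinuousMap.const I (G.vertex v)) G.edge)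
    (fun x => by
      rcases exists_rep x with ⟨v, h⟩ | ⟨e, t, h⟩
      · exact ⟨Sum.inl v, 0, h⟩
      · exact ⟨Sum.inr e, t, h⟩)
    (fun i => eVariationOn_lt_top_of_lipschitz (L := 0) fun a b => by simp)⟩
  have hφ : ∀ e, BoundedVariationOn (φ.toMap ∘ G.edge e) Set.univ := fun e =>
    (eVariationOn_lt_top_of_lipschitz (L := 0) fun a b => by simp [φ]).ne
  obtain ⟨Φ, -, -, -, hi⟩ := exists_immersion_homotopy hn φ φ hφ hφ
  refine ⟨Φ ⟨1 / 2, by norm_num, by norm_num⟩, hi _ (fun h => ?_) fun h => ?_⟩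
  all_goals
    have := congrArg Subtype.val h
    norm_num at this

theorem homeoClass_eq_of_edist_lt_top {n : ℕ} {p q : GraphMap.{u} n} (h : edist p q < ∞) :
    homeoClass p.graph = homeoClass q.graph := by
  obtain ⟨k, -⟩ := iInf_lt_iff.1 h
  exact Quotient.sound ⟨k⟩

/-- The homeomorphism class of the underlying graph of a class of graph-map pairs. -/
noncomputable def GraphMapClass.homeoClass {n : ℕ} : GraphMapClass.{u} n → HomeoClass.{u} :=
  SeparationQuotient.lift (fun p => GraphFrechet.homeoClass p.graph) fun p q h =>
    homeoClass_eq_of_edist_lt_top (by rw [EMetric.inseparable_iff.1 h]; exact ENNReal.zero_lt_top)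

/-- The ball of radius `∞` is a neighbourhood on which the class is constant. -/
theorem GraphMapClass.isLocallyConstant_homeoClass {n : ℕ} :
    IsLocallyConstant (GraphMapClass.homeoClass.{u} (n := n)) := by
  let _ : TopologicalSpace HomeoClass.{u} := ⊥
  have : DiscreteTopology HomeoClass.{u} := ⟨rfl⟩
  refine (IsLocallyConstant.iff_continuous _).2 (SeparationQuotient.continuous_lift ?_)
  refine ((IsLocallyConstant.iff_eventually_eq _).2 fun p => ?_).continuous
  filter_upwards [Metric.eball_mem_nhds p ENNReal.zero_lt_top] with q hq
  exact homeoClass_eq_of_edist_lt_top hq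

end GraphFrechet

theorem mainTheorem6 (n : ℕ) :
    (∀ (G : GraphFrechet.MultiGraph.{u}) (x y : GraphFrechet.immersions n G), Joined x y) ∧
    (2 ≤ n → ∀ G : GraphFrechet.MultiGraph.{u}, PathConnectedSpace (GraphFrechet.immersions n G)) ∧
    ∃ F : ConnectedComponents (GraphFrechet.graphImmersions.{u} n) → GraphFrechet.HomeoClass.{u},
      (∀ (G : GraphFrechet.MultiGraph.{u}) (φ : GraphFrechet.RectMap n G)
        (hφ : GraphFrechet.IsImmersion φ.toMap),
        F (ConnectedComponents.mk (GraphFrechet.immersedPair G φ hφ)) =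
          GraphFrechet.homeoClass G) ∧
      Function.Injective F ∧ (2 ≤ n → Function.Bijective F) := by
  open GraphFrechet in
  -- With discrete target, local constancy becomes continuity and the map factors through the
  -- components.
  let _ : TopologicalSpace HomeoClass.{u} := ⊥
  have : DiscreteTopology HomeoClass.{u} := ⟨rfl⟩
  have hc : Continuous fun x : graphImmersions.{u} n => GraphMapClass.homeoClass x.1 :=
    GraphMapClass.isLocallyConstant_homeoClass.continuous.comp continuous_subtype_val
  have hF : ∀ (G : MultiGraph.{u}) (φ : RectMap n G) (hφ : IsImmersion φ.toMap),
      hc.connectedComponentsLift (ConnectedComponents.mk (immersedPair G φ hφ)) = homeoClass G :=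
    fun G φ hφ => rfl
  have hinj : Function.Injective hc.connectedComponentsLift := by
    intro c d hcd
    obtain ⟨⟨_, ⟨G, φ⟩, hφ, rfl⟩, rfl⟩ := ConnectedComponents.surjective_coe c
    obtain ⟨⟨_, ⟨H, ψ⟩, hψ, rfl⟩, rfl⟩ := ConnectedComponents.surjective_coe d
    obtain ⟨k⟩ : Nonempty (G.Space ≃ₜ H.Space) := Quotient.exact hcd
    -- Pulled back along `k`, `ψ` represents the same point by an immersion of `G`, so a path for
    -- the fixed graph `G` suffices.
    have hψk : IsImmersion (ψ.comp k).toMap := hψ.comp_homeomorph ψ.toMap.continuous k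
    have hj : Joined (immersedPair G φ hφ) (immersedPair H ψ hψ) :=
      immersedPair_comp k hψ hψk ▸ joined_immersedPair hφ hψk
    exact (ConnectedComponents.coe_eq_coe'.2 (pathComponent_subset_component _ hj)).symm
  refine ⟨fun G => joined_immersions, fun hn G => ?_, hc.connectedComponentsLift, hF, hinj,
    fun hn => ⟨hinj, fun c => ?_⟩⟩
  · obtain ⟨φ, hφ⟩ := exists_immersion hn G
    exact ⟨⟨⟨_, φ, hφ, rfl⟩⟩, joined_immersions⟩
  · obtain ⟨G, rfl⟩ := Quotient.exists_rep c
    obtain ⟨φ, hφ⟩ := exists_immersion hn G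
    exact ⟨_, hF G φ hφ⟩
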